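/- **Setting.** Let $\mathbb F$ be the data (finite numbers including subnormals and signed zeros, $\pm\infty$, NaN) of a binary IEEE 754 floating-point format with precision $p\ge 2$ and exponent range $e_{\min}\le 0$, $e_{\max}\ge 1$, with correctly rounded $+,-,\times,\div,\sqrt{\ }$ in the rounding modes to nearest, down and up. Let $A=(a_{ij})\in\mathbb Z^{n\times n}$ be invertible over $\mathbb{Q}$ with columns $a_1,\dots,a_n$, and let $\delta,\eta\in\mathbb R$ satisfy $1/4<\delta\le 1$ and $1/2\le\eta<\sqrt\delta$. Let $a_i^*$ be the Gram–Schmidt vectors and $\mu_{ij}=\langle a_i,a_j^*\rangle/\|a_j^*\|_2^2$. The basis $(a_i)$ of the lattice generated by the columns is LLL-reduced with parameters $(\delta,\eta)$ if $|\mu_{ij}|\le\eta$ for $j<i$ and $(\delta-\mu_{i+1,i}^2)\|a_i^*\|_2^2\le\|a_{i+1}^*\|_2^2$ for $1\le i\le n-1$. Let $R$ be the QR factor of $A$: $A=QR$ with $Q$ orthogonal and $R$ upper triangular with positive diagonal. **The reducedness certificate.** All steps are performed in $\mathbb F$. Matrix products are plain sums of products, restricted to the structurally nonzero terms for triangular factors,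 and for symmetric results only the upper triangle is computed. "Bound" means an upper bound computed with directed rounding. 1. Convert $A$ to nearest and compute an upper triangular $\widetilde R$ by modified Gram–Schmidt. 2. Convert $A$ downwards and upwards to $A_-,A_+$, so $A\in[A_-,A_+]$. Compute $V\approx\widetilde R^{-1}$ by back substitution and an enclosure of $W=\widetilde RV$ by rounding down and up. Let $w$ be a bound on $\|W-I\|_\infty$, and test $w<1$. Let $B$ be a bound on $|2I-W|+\frac{w^2}{1-w}\,\mathrm{triu}(\mathbf 1\mathbf 1^T)\ (\ge|W^{-1}|)$. Enclose $AV$, choosing the endpoint $A_-$ or $A_+$ according to the sign of the entry of $V$. By midpoint–radius arithmetic compute bounds $X\ge|V^TA^TAV-I|$ and $Y\ge|W^TW-I|$. Let $\overline{G}$ be a bound on $B^T(X+Y)B$ and $g$ a bound on $\|\overline{G}\|_\infty$, and test $g<1$. Let $H$ be a bound on $\mathrm{triu}(\overline{G})+\frac{g^2}{1-g}\mathrm{triu}(\mathbf 1\mathbf 1^T)$ and $F$ a bound on $H|\widetilde R|$. If a test fails, set all entries of $F$ to $+\infty$. 3. Test that $F$ is finite. Test properness for all $i<j$: $t_j\le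 t_i$, where $t_i$ is $(\widetilde r_{ii}-f_{ii})\,\eta$ rounded down and $t_j$ is $|\widetilde r_{ij}|+f_{ij}$ rounded up. Test the Lovász condition for all $i<n$: $\sqrt t\;t_i\le t_{i+1}$, where $t_i$ is $\widetilde r_{ii}+f_{ii}$ rounded up, $t_{i+1}$ is $\widetilde r_{i+1,i+1}-f_{i+1,i+1}$ rounded down, $t$ is an upper bound, by directed rounding, on $\delta-\big(\max(|\widetilde r_{i,i+1}|-f_{i,i+1},0)/t_i\big)^2$, and $\sqrt t\;t_i$ is rounded up. Comparisons with NaN are false. If all tests succeed the certificate answers "reduced", otherwise "failed". **Theorem 4.** There is an absolute constant $C$, independent of $n$, $A$, $\delta$, $\eta$ and the format, such that, in the above setting: - for $n\ge1$ the number $N$ of floating-point operations of the certificate (arithmetic operations, square roots, comparisons, maxima, absolute values, negations, conversions) satisfies $|N-12n^3|\le Cn^2$, so it is $12n^3+O(n^2)$; - the QR factor $R$ exists and is unique, with $\|a_i^*\|_2=r_{ii}$ and $\mu_{ij}=r_{ji}/r_{jj}$ for $j<i$; and if all entries of $F$ are finite, then $\widetilde R$ is finite and $|\widetilde R-R|\le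 F$ entrywise; - the certificate either returns "failed", or it returns "reduced" and the columns of $A$ form an LLL-reduced basis with parameters $(\delta,\eta)$. -/

import Mathlib

/-! ## Binary floating point arithmetic (IEEE 754) -/

/-- A binary floating point format: `prec` significant bits, exponent range `emin .. emax`. -/
structure FloatFormat where
  prec : ℕ
  emin : ℤ
  emax : ℤ
  two_le_prec : 2 ≤ prec
  emin_nonpos : emin ≤ 0
  one_le_emax : 1 ≤ emax

/-- The rounding modes used by the certificate: to nearest (ties to even),
downwards (towards `-∞`) and upwards (towards `+∞`). -/
inductive Rounding where
  | nearest
  | down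
  | up

namespace FloatFormat

/-- The magnitudes of the finite numbers of the format, normal and subnormal:
`m * 2 ^ e` with `m < 2 ^ prec` and `emin ≤ e + prec - 1 ≤ emax`. -/
def IsMagnitude (φ : FloatFormat) (a : ℝ) : Prop :=
  ∃ (m : ℕ) (e : ℤ), m < 2 ^ φ.prec ∧ φ.emin ≤ e + ((φ.prec : ℤ) - 1) ∧
    e + ((φ.prec : ℤ) - 1) ≤ φ.emax ∧ a = (m : ℝ) * (2 : ℝ) ^ e

/-- The largest finite number of the format. -/
noncomputable def maxFinite (φ : FloatFormat) : ℝ :=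
  ((2 ^ φ.prec - 1 : ℕ) : ℝ) * (2 : ℝ) ^ (φ.emax - ((φ.prec : ℤ) - 1))

theorem isMagnitude_maxFinite (φ : FloatFormat) : φ.IsMagnitude φ.maxFinite := by
  refine ⟨2 ^ φ.prec - 1, φ.emax - ((φ.prec : ℤ) - 1), ?_, ?_, ?_, rfl⟩
  · exact Nat.sub_lt (by positivity) one_pos
  · have h1 := φ.emin_nonpos
    have h2 := φ.one_le_emax
    linarith
  · linarith

theorem isMagnitude_zero (φ : FloatFormat) : φ.IsMagnitude 0 := by
  refine ⟨0, φ.emax - ((φ.prec : ℤ) - 1), by positivity, ?_, ?_, by simp⟩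
  · have h1 := φ.emin_nonpos
    have h2 := φ.one_le_emax
    linarith
  · linarith

/-- The exponent of the unit in the last place at the magnitude `a`. -/
noncomputable def ulpExp (φ : FloatFormat) (a : ℝ) : ℤ :=
  max (Int.log 2 a) φ.emin - ((φ.prec : ℤ) - 1)

end FloatFormat

/-- The integer nearest to `y ≥ 0`, ties going to the even one. -/
noncomputable def roundHalfEven (y : ℝ) : ℕ :=
  if y - (⌊y⌋₊ : ℝ) < 1 / 2 then ⌊y⌋₊
  else if 1 / 2 < y - (⌊y⌋₊ : ℝ) then ⌊y⌋₊ + 1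
  else if Even ⌊y⌋₊ then ⌊y⌋₊ else ⌊y⌋₊ + 1

/-- What a rounding mode does to the magnitude of a number of the given sign. -/
noncomputable def Rounding.roundNat (mode : Rounding) (neg : Bool) (y : ℝ) : ℕ :=
  match mode, neg with
  | .nearest, _ => roundHalfEven y
  | .down, false => ⌊y⌋₊
  | .down, true => ⌈y⌉₊
  | .up, false => ⌈y⌉₊
  | .up, true => ⌊y⌋₊

/-- The data of the format: NaN, the two infinities, and the signed finite numbers
(with two zeros). `neg = true` is the minus sign. -/
inductive Flt (φ : FloatFormat) where
  | nan : Flt φ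
  | inf (neg : Bool) : Flt φ
  | fin (neg : Bool) (mag : ℝ) (h : φ.IsMagnitude mag) : Flt φ

namespace Flt

variable {φ : FloatFormat}

/-- Overflow of a number of the given sign: the largest finite number when the rounding is
directed towards zero, an infinity otherwise. -/
noncomputable def overflow (mode : Rounding) (neg : Bool) : Flt φ :=
  match mode, neg with
  | .down, false => fin false φ.maxFinite φ.isMagnitude_maxFinite
  | .up, true => fin true φ.maxFinite φ.isMagnitude_maxFinite
  | _, s => inf s

open Classical in
/-- Correct rounding of the real number `x`. The sign of an exact zero is `zeroNeg`. The number
is rounded to `prec` bits (to a multiple of the smallest subnormal number below `2 ^ emin`); if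
the outcome is too large for the format, the operation overflows. -/
noncomputable def round (mode : Rounding) (zeroNeg : Bool) (x : ℝ) : Flt φ :=
  let s : Bool := if x = 0 then zeroNeg else decide (x < 0)
  let u : ℝ := (2 : ℝ) ^ φ.ulpExp |x|
  let b : ℝ := (mode.roundNat s (|x| / u) : ℝ) * u
  if h : φ.IsMagnitude b then fin s b h else overflow mode s

/-- Conversion of a real number. -/
noncomputable def ofReal (mode : Rounding) (x : ℝ) : Flt φ := round mode false x

noncomputable def zero : Flt φ := fin false 0 φ.isMagnitude_zero

noncomputable def one : Flt φ := ofReal .nearest 1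

noncomputable def two : Flt φ := ofReal .nearest 2

/-- The real value of a finite number (and `0` on the other data). -/
noncomputable def toReal : Flt φ → ℝ
  | nan => 0
  | inf _ => 0
  | fin true a _ => -a
  | fin false a _ => a

/-- The value in the extended reals (and `0` on NaN). -/
noncomputable def toEReal : Flt φ → EReal
  | nan => 0
  | inf true => ⊥
  | inf false => ⊤
  | fin true a _ => ((-a : ℝ) : EReal)
  | fin false a _ => (a : EReal)

def IsFinite : Flt φ → Prop
  | fin _ _ _ => True
  | _ => False

def IsNaN : Flt φ → Prop
  | nan => True
  | _ => False

open Classical in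
/-- The comparison `a ≤ b`, false as soon as one of the operands is NaN. -/
noncomputable def leB (a b : Flt φ) : Bool :=
  decide (¬ a.IsNaN ∧ ¬ b.IsNaN ∧ a.toEReal ≤ b.toEReal)

open Classical in
/-- The comparison `a < b`, false as soon as one of the operands is NaN. -/
noncomputable def ltB (a b : Flt φ) : Bool :=
  decide (¬ a.IsNaN ∧ ¬ b.IsNaN ∧ a.toEReal < b.toEReal)

open Classical in
/-- The maximum; NaN is propagated. -/
noncomputable def max (a b : Flt φ) : Flt φ :=
  if a.IsNaN ∨ b.IsNaN then nan else if leB a b then b else a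

def neg : Flt φ → Flt φ
  | nan => nan
  | inf s => inf (!s)
  | fin s a h => fin (!s) a h

def abs : Flt φ → Flt φ
  | nan => nan
  | inf _ => inf false
  | fin _ a h => fin false a h

/-- Addition. An exact zero sum of operands of opposite signs is `+0`, or `-0` when rounding
downwards. -/
noncomputable def add (mode : Rounding) (a b : Flt φ) : Flt φ :=
  match a, b with
  | nan, _ => nan
  | _, nan => nan
  | inf s, inf t => if s = t then inf s else nan
  | inf s, fin _ _ _ => inf s
  | fin _ _ _, inf t => inf t
  | fin s x hx, fin t y hy =>
      round mode (if s = t then s else match mode with | .down => true | _ => false)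
        ((fin s x hx).toReal + (fin t y hy).toReal)

noncomputable def sub (mode : Rounding) (a b : Flt φ) : Flt φ := add mode a b.neg

open Classical in
noncomputable def mul (mode : Rounding) (a b : Flt φ) : Flt φ :=
  match a, b with
  | nan, _ => nan
  | _, nan => nan
  | inf s, inf t => inf (xor s t)
  | inf s, fin t y _ => if y = 0 then nan else inf (xor s t)
  | fin s x _, inf t => if x = 0 then nan else inf (xor s t)
  | fin s x hx, fin t y hy =>
      round mode (xor s t) ((fin s x hx).toReal * (fin t y hy).toReal)

open Classical in
noncomputable def div (mode : Rounding) (a b : Flt φ) : Flt φ :=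
  match a, b with
  | nan, _ => nan
  | _, nan => nan
  | inf _, inf _ => nan
  | inf s, fin t _ _ => inf (xor s t)
  | fin s _ _, inf t => fin (xor s t) 0 φ.isMagnitude_zero
  | fin s x hx, fin t y hy =>
      if y = 0 then (if x = 0 then nan else inf (xor s t))
      else round mode (xor s t) ((fin s x hx).toReal / (fin t y hy).toReal)

open Classical in
/-- Square root; `√(-0) = -0`, and the root of a negative number is NaN. -/
noncomputable def sqrt (mode : Rounding) (a : Flt φ) : Flt φ :=
  match a with
  | nan => nan
  | inf true => nan
  | inf false => inf false
  | fin s x _ => if x = 0 then a else if s then nan else round mode false (Real.sqrt x)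

end Flt

/-! ## Computations with an operation count -/

/-- A value together with the number of floating point operations spent on it. -/
structure Counted (α : Type) where
  val : α
  ops : ℕ

namespace Counted

instance : Monad Counted where
  pure a := ⟨a, 0⟩
  bind x f := ⟨(f x.val).val, x.ops + (f x.val).ops⟩

/-- The loop computing a vector entry by entry. -/
def vec {n : ℕ} {α : Type} (f : Fin n → Counted α) : Counted (Fin n → α) :=
  ⟨fun i => (f i).val, ∑ i, (f i).ops⟩

/-- The double loop computing a matrix entry by entry. -/
def mat {n : ℕ} {α : Type} (f : Fin n → Fin n → Counted α) : Counted (Fin n → Fin n → α) :=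
  vec fun i => vec fun j => f i j

end Counted

namespace LLLCertificate

open Counted

variable {φ : FloatFormat} {n : ℕ}

/-! Each elementary operation, including comparisons, maxima, absolute values, negations and
conversions, counts for one. -/

noncomputable def add (m : Rounding) (a b : Flt φ) : Counted (Flt φ) := ⟨Flt.add m a b, 1⟩
noncomputable def sub (m : Rounding) (a b : Flt φ) : Counted (Flt φ) := ⟨Flt.sub m a b, 1⟩
noncomputable def mul (m : Rounding) (a b : Flt φ) : Counted (Flt φ) := ⟨Flt.mul m a b, 1⟩
noncomputable def div (m : Rounding) (a b : Flt φ) : Counted (Flt φ) := ⟨Flt.div m a b, 1⟩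
noncomputable def sqrt (m : Rounding) (a : Flt φ) : Counted (Flt φ) := ⟨Flt.sqrt m a, 1⟩
noncomputable def neg (a : Flt φ) : Counted (Flt φ) := ⟨Flt.neg a, 1⟩
noncomputable def abs (a : Flt φ) : Counted (Flt φ) := ⟨Flt.abs a, 1⟩
noncomputable def max (a b : Flt φ) : Counted (Flt φ) := ⟨Flt.max a b, 1⟩
noncomputable def le (a b : Flt φ) : Counted Bool := ⟨Flt.leB a b, 1⟩
noncomputable def lt (a b : Flt φ) : Counted Bool := ⟨Flt.ltB a b, 1⟩
noncomputable def conv (m : Rounding) (x : ℝ) : Counted (Flt φ) := ⟨Flt.ofReal m x, 1⟩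

/-- Square matrices of floating point data. -/
abbrev FMat (φ : FloatFormat) (n : ℕ) := Fin n → Fin n → Flt φ

/-- The indices satisfying `P`, in increasing order. -/
def idx (P : Fin n → Prop) [DecidablePred P] : List (Fin n) :=
  (List.finRange n).filter fun k => decide (P k)

/-- The inner product `∑ k ∈ l, f k * g k`, all operations in the rounding mode `m`. -/
noncomputable def dot (m : Rounding) (l : List (Fin n)) (f g : Fin n → Flt φ) :
    Counted (Flt φ) :=
  l.foldlM (fun acc k => do
    let p ← mul m (f k) (g k)
    add m acc p) Flt.zero

/-- An upper triangular matrix, of which only the upper triangular part is computed. -/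
noncomputable def upperMat (f : Fin n → Fin n → Counted (Flt φ)) : Counted (FMat φ n) :=
  mat fun i j => if i ≤ j then f i j else pure Flt.zero

/-- A symmetric matrix, of which only the upper triangular part is computed. -/
noncomputable def symMat (f : Fin n → Fin n → Counted (Flt φ)) : Counted (FMat φ n) := do
  let U ← upperMat f
  pure fun i j => if i ≤ j then U i j else U j i

/-- The entries of the identity matrix. -/
noncomputable def idEntry (i j : Fin n) : Flt φ := if i = j then Flt.one else Flt.zero

/-- The entries of twice the identity matrix. -/
noncomputable def twoIdEntry (i j : Fin n) : Flt φ := if i = j then Flt.two else Flt.zero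

/-- Upper bound on the infinity norm of a matrix with nonnegative entries. -/
noncomputable def normInf (M : FMat φ n) : Counted (Flt φ) := do
  let rows ← vec fun i => (List.finRange n).foldlM (fun acc j => add .up acc (M i j)) Flt.zero
  (List.finRange n).foldlM (fun acc i => max acc (rows i)) Flt.zero

/-- Upper bound on `|x - c|` for all `x ∈ [lo, hi]`. -/
noncomputable def absSubBound (lo hi c : Flt φ) : Counted (Flt φ) := do
  let a ← sub .down lo c
  let b ← sub .up hi c
  let a ← abs a
  let b ← abs b
  max a b

/-- Upper bound on `g ^ 2 / (1 - g)`, for `g < 1`. -/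
noncomputable def geomTail (g : Flt φ) : Counted (Flt φ) := do
  let d ← sub .up g Flt.one
  let d ← neg d
  let s ← mul .up g g
  div .up s d

/-- Modified Gram-Schmidt orthogonalization, rounding to nearest: step `k` on the current columns
and the rows of the triangular factor found so far. -/
noncomputable def mgsStep (st : FMat φ n × FMat φ n) (k : Fin n) :
    Counted (FMat φ n × FMat φ n) := do
  let a := st.1
  let s ← dot .nearest (List.finRange n) (fun i => a i k) (fun i => a i k)
  let rkk ← sqrt .nearest s
  let q ← vec fun i => div .nearest (a i k) rkk
  let row ← vec fun j =>
    if j = k then pure rkk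
    else if k < j then dot .nearest (List.finRange n) q (fun i => a i j)
    else pure Flt.zero
  let a' ← mat fun i j =>
    if k < j then do
      let p ← mul .nearest (row j) (q i)
      sub .nearest (a i j) p
    else pure (a i j)
  pure (a', Function.update st.2 k row)

/-- The approximate triangular factor of a floating point matrix. -/
noncomputable def mgs (A : FMat φ n) : Counted (FMat φ n) := do
  let st ← (List.finRange n).foldlM mgsStep (A, fun _ _ => Flt.zero)
  pure st.2

/-- Approximate inverse of an upper triangular matrix by back substitution, row by row from the
last one, rounding to nearest. -/
noncomputable def triInv (R : FMat φ n) : Counted (FMat φ n) :=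
  (List.finRange n).reverse.foldlM (fun V i => do
    let row ← vec fun j =>
      if i = j then div .nearest Flt.one (R i i)
      else if i < j then do
        let s ← dot .nearest (idx fun k => i < k ∧ k ≤ j) (R i) (fun k => V k j)
        let s ← neg s
        div .nearest s (R i i)
      else pure Flt.zero
    pure (Function.update V i row)) (fun _ _ => Flt.zero)

/-- Upper bound on `|Xᵀ X - I|` for all `X ∈ [Xlo, Xhi]`, through the midpoint-radius
representation of `X`. The `(i, j)` entry, `i ≤ j`, of `Xᵀ X` is a sum over the indices
`K i`. -/
noncomputable def gramBound (K : Fin n → List (Fin n)) (Xlo Xhi : FMat φ n) :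
    Counted (FMat φ n) := do
  let mid ← mat fun i j => do
    let t ← sub .up (Xhi i j) (Xlo i j)
    let t ← div .up t Flt.two
    add .up (Xlo i j) t
  let rad ← mat fun i j => sub .up (mid i j) (Xlo i j)
  let amid ← mat fun i j => abs (mid i j)
  let asum ← mat fun i j => add .up (amid i j) (rad i j)
  symMat fun i j => do
    let lo ← dot .down (K i) (fun k => mid k i) (fun k => mid k j)
    let hi ← dot .up (K i) (fun k => mid k i) (fun k => mid k j)
    let c ← absSubBound lo hi (idEntry i j)
    let p ← dot .up (K i) (fun k => amid k i) (fun k => rad k j)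
    let q ← dot .up (K i) (fun k => rad k i) (fun k => asum k j)
    let c ← add .up c p
    add .up c q

/-- The error bounding algorithm: from an upper triangular `R'` and an enclosure `[Alo, Ahi]` of a
matrix `A`, an entrywise bound on the distance from `R'` to the `QR` factor of `A`. All entries of
the result are infinite when the required checks do not succeed. -/
noncomputable def errorBound (Alo Ahi R' : FMat φ n) : Counted (FMat φ n) := do
  let V ← triInv R'
  -- enclosure of `W = R' V`, and the invertibility check `‖W - I‖ < 1`
  let Wlo ← upperMat fun i j => dot .down (idx fun k => i ≤ k ∧ k ≤ j) (R' i) (fun k => V k j)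
  let Whi ← upperMat fun i j => dot .up (idx fun k => i ≤ k ∧ k ≤ j) (R' i) (fun k => V k j)
  let D ← upperMat fun i j => absSubBound (Wlo i j) (Whi i j) (idEntry i j)
  let w ← normInf D
  let okW ← lt w Flt.one
  -- bound on `|W⁻¹|`
  let D2 ← upperMat fun i j => absSubBound (Wlo i j) (Whi i j) (twoIdEntry i j)
  let sW ← geomTail w
  let B ← upperMat fun i j => add .up (D2 i j) sW
  -- bound on `|Wᵀ W - I|`
  let Y ← gramBound (fun i => idx fun k => k ≤ i) Wlo Whi
  -- enclosure of `A V`, the endpoint of each entry of `A` being chosen after the sign of `V k j`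
  let S ← mat fun k j => le Flt.zero (V k j)
  let Ulo ← mat fun i j => dot .down (idx fun k => k ≤ j)
    (fun k => if S k j then Alo i k else Ahi i k) (fun k => V k j)
  let Uhi ← mat fun i j => dot .up (idx fun k => k ≤ j)
    (fun k => if S k j then Ahi i k else Alo i k) (fun k => V k j)
  -- bound on `|Vᵀ Aᵀ A V - I|`
  let X ← gramBound (fun _ => List.finRange n) Ulo Uhi
  -- bound on `G = |R'⁻ᵀ Aᵀ A R'⁻¹ - I|`, and the spectral radius check `‖G‖ < 1`
  let T ← mat fun i j => add .up (X i j) (Y i j)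
  let TB ← mat fun i j => dot .up (idx fun k => k ≤ j) (T i) (fun k => B k j)
  let G ← symMat fun i j => dot .up (idx fun k => k ≤ i) (fun k => B k i) (fun k => TB k j)
  let g ← normInf G
  let okG ← lt g Flt.one
  -- bound on `H = triu (G (I - G)⁻¹)`, and the product `H |R'|`
  let sG ← geomTail g
  let H ← upperMat fun i j => add .up (G i j) sG
  let absR ← mat fun i j => abs (R' i j)
  let F ← upperMat fun i j =>
    dot .up (idx fun k => i ≤ k ∧ k ≤ j) (H i) (fun k => absR k j)
  pure (if okW && okG then F else fun _ _ => Flt.inf false)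

/-- The test that all entries of a matrix are finite. -/
noncomputable def finiteTest (F : FMat φ n) : Counted Bool := do
  let t ← mat fun i j => do
    let a ← abs (F i j)
    lt a (Flt.inf false)
  pure (decide (∀ i j, t i j = true))

/-- The properness test. -/
noncomputable def properTest (R' F : FMat φ n) (η : ℝ) : Counted Bool := do
  let ηlo ← conv .down η
  let t ← mat fun i j =>
    if i < j then do
      let d ← sub .down (R' i i) (F i i)
      let ti ← mul .down d ηlo
      let a ← abs (R' i j)
      let tj ← add .up a (F i j)
      le tj ti
    else pure true
  pure (decide (∀ i j, t i j = true))

/-- The test of the Lovász conditions. -/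
noncomputable def lovaszTest (R' F : FMat φ n) (δ : ℝ) : Counted Bool := do
  let δhi ← conv .up δ
  let t ← vec fun i : Fin n =>
    if h : (i : ℕ) + 1 < n then do
      let i' : Fin n := ⟨i + 1, h⟩
      let ti ← add .up (R' i i) (F i i)
      let tn ← sub .down (R' i' i') (F i' i')
      let a ← abs (R' i i')
      let a ← sub .down a (F i i')
      let a ← max a Flt.zero
      let q ← div .down a ti
      let q ← mul .down q q
      let t ← sub .down q δhi
      let t ← neg t
      let t ← sqrt .up t
      let t ← mul .up t ti
      le t tn
    else pure true
  pure (decide (∀ i, t i = true))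

/-- The two possible answers. -/
inductive Answer where
  | reduced
  | failed

/-- The approximate factor, the error bound and the answer of a run of the certificate. -/
structure Output (φ : FloatFormat) (n : ℕ) where
  Rapprox : FMat φ n
  F : FMat φ n
  answer : Answer

/-- The reducedness certificate for the columns of an integer matrix `A`. -/
noncomputable def certificate (φ : FloatFormat) (A : Matrix (Fin n) (Fin n) ℤ) (δ η : ℝ) :
    Counted (Output φ n) := do
  let A0 ← mat fun i j => conv .nearest (A i j : ℝ)
  let R' ← mgs A0
  let Alo ← mat fun i j => conv .down (A i j : ℝ)
  let Ahi ← mat fun i j => conv .up (A i j : ℝ)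
  let F ← errorBound Alo Ahi R'
  let t1 ← finiteTest F
  let t2 ← properTest R' F η
  let t3 ← lovaszTest R' F δ
  pure ⟨R', F, if t1 && t2 && t3 then .reduced else .failed⟩

end LLLCertificate

/-! ## `QR` factor and LLL-reducedness -/

/-- `R` is the triangular factor of the `QR` factorization of `A`: `A = Q R` with `Q` orthogonal and
`R` upper triangular with positive diagonal. -/
def IsQRFactor {n : ℕ} (A R : Matrix (Fin n) (Fin n) ℝ) : Prop :=
  (∃ Q : Matrix (Fin n) (Fin n) ℝ, Q.transpose * Q = 1 ∧ A = Q * R) ∧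
    (∀ i j, j < i → R i j = 0) ∧ ∀ i, 0 < R i i

/-- The columns of an integer matrix, as vectors of Euclidean space. -/
noncomputable def latticeCol {n : ℕ} (A : Matrix (Fin n) (Fin n) ℤ) (j : Fin n) :
    EuclideanSpace ℝ (Fin n) :=
  WithLp.toLp 2 fun i => (A i j : ℝ)

/-- The Gram-Schmidt vectors of the columns. -/
noncomputable def gsVec {n : ℕ} (A : Matrix (Fin n) (Fin n) ℤ) (j : Fin n) :
    EuclideanSpace ℝ (Fin n) :=
  InnerProductSpace.gramSchmidt ℝ (latticeCol A) j

/-- The Gram-Schmidt coefficients `⟨a_i, a_j*⟩ / ‖a_j*‖ ^ 2`. -/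
noncomputable def gsCoeff {n : ℕ} (A : Matrix (Fin n) (Fin n) ℤ) (i j : Fin n) : ℝ :=
  inner ℝ (latticeCol A i) (gsVec A j) / ‖gsVec A j‖ ^ 2

/-- The columns of `A` form an LLL-reduced basis (of the lattice that they generate) with parameters
`(δ, η)`: they are linearly independent, proper for `η`, and satisfy the Lovász conditions. -/
def IsLLLReduced {n : ℕ} (A : Matrix (Fin n) (Fin n) ℤ) (δ η : ℝ) : Prop :=
  LinearIndependent ℝ (latticeCol A) ∧
    (∀ i j : Fin n, j < i → |gsCoeff A i j| ≤ η) ∧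
    ∀ i i' : Fin n, (i' : ℕ) = (i : ℕ) + 1 →
      (δ - gsCoeff A i' i ^ 2) * ‖gsVec A i‖ ^ 2 ≤ ‖gsVec A i'‖ ^ 2

/-! The error bound is a posteriori: nothing is assumed about the accuracy of the computed `R'` and
`V`. Of the floating-point Gram-Schmidt process only the triangular shape and the nonnegative
diagonal of `R'` are used. Take real values and put W = R'V. If ‖W - I‖∞ ≤ w < 1, then W is
invertible and W⁻¹ = 2I - W + W⁻¹(I - W)², where the last term is entrywise at most w²/(1 - w)
(`inv_near_one`). Since R'⁻¹ = V W⁻¹, the backward error G = R'⁻ᵀAᵀAR'⁻¹ - I equals W⁻ᵀ((VᵀAᵀAV - I)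
- (WᵀW - I))W⁻¹ (`gram_error_eq`), and every factor on the right has a computable bound.

U = RR'⁻¹ is the Cholesky factor of I + G. For the lower triangular L = U⁻ᵀ one has U - L = LG. The
strict upper part of LG is that of U, its strict lower part is that of -L, and a diagonal entry u -
1/u dominates both u - 1 and 1/u - 1. So U - I and L - I are entrywise dominated by LG = G + (L -
I)G; this forces ‖LG‖ ≤ g/(1 - g) and leaves a second-order term of at most g²/(1 - g)
(`cholesky_near_one`). Multiplication by R' gives the bound F on R - R' (`IsQRFactor.abs_sub_le`).

Floating point enters only through one-sided inequalities. A finite sum or product has finite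
operands, and directed rounding puts it on the known side of the exact value. Hence finiteness of F
is traced backwards to all data it depends on (`errorBound_spec`), and overflow need not be followed
forwards. Division by an infinity and comparisons involving -∞ escape this principle and are handled
separately.

The tests enclose each entry of R by `R'` and F with every rounding in the safe direction, and R
carries the Gram-Schmidt data of A (`properTest_spec`, `lovaszTest_spec`). The cost of each loop
does not depend on the data; Gram-Schmidt contributes 2n³ operations and the error bound 10n³. -/

/-! ## Correct rounding -/

namespace FloatFormat

variable {φ : FloatFormat}

theorem IsMagnitude.nonneg {a : ℝ} (h : φ.IsMagnitude a) : 0 ≤ a := by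
  obtain ⟨m, e, -, -, -, rfl⟩ := h
  positivity

theorem maxFinite_nonneg (φ : FloatFormat) : 0 ≤ φ.maxFinite := φ.isMagnitude_maxFinite.nonneg

theorem maxFinite_le (φ : FloatFormat) : φ.maxFinite ≤ (2 : ℝ) ^ (φ.emax + 1) := by
  have h : (((2 ^ φ.prec - 1 : ℕ)) : ℝ) ≤ (2 : ℝ) ^ (φ.prec : ℤ) := by
    rw [zpow_natCast]
    have : 2 ^ φ.prec - 1 ≤ 2 ^ φ.prec := Nat.sub_le _ _
    exact_mod_cast this
  calc φ.maxFinite ≤ (2 : ℝ) ^ (φ.prec : ℤ) * (2 : ℝ) ^ (φ.emax - ((φ.prec : ℤ) - 1)) := by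
        unfold maxFinite
        gcongr
    _ = (2 : ℝ) ^ (φ.emax + 1) := by
        rw [← zpow_add₀ two_ne_zero]
        congr 1
        ring

theorem isMagnitude_two_zpow (φ : FloatFormat) {k : ℤ} (h1 : φ.emin ≤ k) (h2 : k ≤ φ.emax) :
    φ.IsMagnitude ((2 : ℝ) ^ k) := by
  have h := φ.two_le_prec
  refine ⟨2 ^ (φ.prec - 1), k - (φ.prec - 1), ?_, by linarith, by linarith, ?_⟩
  · exact Nat.pow_lt_pow_right (by norm_num) (by omega)
  · push_cast
    rw [← zpow_natCast, ← zpow_add₀ two_ne_zero]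
    congr 1
    omega

theorem isMagnitude_one (φ : FloatFormat) : φ.IsMagnitude 1 := by
  have h := φ.isMagnitude_two_zpow (k := 0) φ.emin_nonpos (by linarith [φ.one_le_emax])
  simpa using h

theorem isMagnitude_two (φ : FloatFormat) : φ.IsMagnitude 2 := by
  have h := φ.isMagnitude_two_zpow (k := 1) (by linarith [φ.emin_nonpos]) φ.one_le_emax
  simpa using h

/-- Truncation to `prec` bits leaves the format only beyond the largest finite number. -/
theorem maxFinite_le_of_not_isMagnitude_floor {y : ℝ} (hy : 0 ≤ y)
    (h : ¬ φ.IsMagnitude ((⌊y / (2 : ℝ) ^ φ.ulpExp y⌋₊ : ℝ) * (2 : ℝ) ^ φ.ulpExp y)) :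
    φ.maxFinite ≤ y := by
  by_contra! hlt
  apply h
  have hyp : y < (2 : ℝ) ^ (φ.emax + 1) := hlt.trans_le φ.maxFinite_le
  have hle : Max.max (Int.log 2 y) φ.emin ≤ φ.emax := by
    refine max_le ?_ (by linarith [φ.emin_nonpos, φ.one_le_emax])
    rcases hy.eq_or_lt with rfl | hpos
    · rw [Int.log_zero_right]
      linarith [φ.one_le_emax]
    · have := (Int.lt_zpow_iff_log_lt (b := 2) (by norm_num) hpos).1 (by exact_mod_cast hyp)
      omega
  refine ⟨_, _, ?_, ?_, ?_, rfl⟩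
  · rw [Nat.floor_lt (by positivity), div_lt_iff₀ (by positivity)]
    push_cast
    rw [← zpow_natCast, ← zpow_add₀ two_ne_zero]
    have h1 : y < (2 : ℝ) ^ (Int.log 2 y + 1) := by
      exact_mod_cast Int.lt_zpow_succ_log_self (b := 2) (by norm_num) y
    refine h1.trans_le (zpow_le_zpow_right₀ (by norm_num) ?_)
    unfold ulpExp
    have := le_max_left (Int.log 2 y) φ.emin
    linarith
  · unfold ulpExp
    have := le_max_right (Int.log 2 y) φ.emin
    linarith
  · unfold ulpExp
    linarith

/-- This is why rounding fixes the numbers of the format. In any representation m·2^e, normalized or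
not, m < 2^prec keeps the ulp exponent of the value at most e, so the value is an integral multiple
of its own ulp. -/
theorem IsMagnitude.exists_nat_div {a : ℝ} (h : φ.IsMagnitude a) :
    ∃ k : ℕ, a / (2 : ℝ) ^ φ.ulpExp a = k := by
  obtain ⟨m, e, hm, h1, h2, rfl⟩ := h
  rcases Nat.eq_zero_or_pos m with rfl | hpos
  · exact ⟨0, by simp⟩
  have hle : φ.ulpExp ((m : ℝ) * (2 : ℝ) ^ e) ≤ e := by
    unfold ulpExp
    have hlog : Int.log 2 ((m : ℝ) * (2 : ℝ) ^ e) < e + φ.prec := by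
      refine (Int.lt_zpow_iff_log_lt (b := 2) (by norm_num) (by positivity)).1 ?_
      push_cast
      rw [add_comm, zpow_add₀ two_ne_zero, zpow_natCast]
      gcongr
      exact_mod_cast hm
    have : Max.max (Int.log 2 ((m : ℝ) * (2 : ℝ) ^ e)) φ.emin ≤ e + ((φ.prec : ℤ) - 1) :=
      max_le (by omega) h1
    linarith
  obtain ⟨d, hd⟩ := Int.le.dest hle
  refine ⟨m * 2 ^ d, ?_⟩
  set u := φ.ulpExp ((m : ℝ) * (2 : ℝ) ^ e)
  rw [← hd, zpow_add₀ two_ne_zero, zpow_natCast]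
  push_cast
  field_simp

end FloatFormat

theorem roundHalfEven_natCast (k : ℕ) : roundHalfEven (k : ℝ) = k := by
  simp [roundHalfEven]

theorem Rounding.roundNat_natCast (mode : Rounding) (s : Bool) (k : ℕ) :
    mode.roundNat s (k : ℝ) = k := by
  cases mode <;> cases s <;> simp [Rounding.roundNat, roundHalfEven_natCast]

namespace Flt

variable {φ : FloatFormat}

theorem toReal_fin_false {a : ℝ} (h : φ.IsMagnitude a) : (fin false a h).toReal = a := rfl

theorem toReal_fin_true {a : ℝ} (h : φ.IsMagnitude a) : (fin true a h).toReal = -a := rfl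

theorem IsFinite.toEReal_eq {a : Flt φ} (h : a.IsFinite) : a.toEReal = (a.toReal : EReal) := by
  match a, h with
  | fin true _ _, _ => rfl
  | fin false _ _, _ => rfl

theorem IsFinite.not_isNaN {a : Flt φ} (h : a.IsFinite) : ¬ a.IsNaN := by
  match a, h with
  | fin _ _ _, _ => exact id

theorem isFinite_of_ne {a : Flt φ} (h0 : ¬ a.IsNaN) (h1 : a ≠ inf true) (h2 : a ≠ inf false) :
    a.IsFinite := by
  match a with
  | nan => exact absurd trivial h0
  | inf true => exact absurd rfl h1
  | inf false => exact absurd rfl h2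
  | fin _ _ _ => trivial

/-- The rounding of a number whose magnitude belongs to the format is exact. -/
theorem round_of_isMagnitude (mode : Rounding) (z : Bool) {x : ℝ} (h : φ.IsMagnitude |x|) :
    (round mode z x : Flt φ).IsFinite ∧ (round mode z x : Flt φ).toReal = x := by
  obtain ⟨k, hk⟩ := h.exists_nat_div
  have hu : (2 : ℝ) ^ φ.ulpExp |x| ≠ 0 := by positivity
  have hb : (k : ℝ) * (2 : ℝ) ^ φ.ulpExp |x| = |x| := by
    rw [← hk]
    field_simp
  unfold round
  simp only [hk, Rounding.roundNat_natCast, hb, h, dite_true]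
  refine ⟨trivial, ?_⟩
  rcases lt_trichotomy x 0 with hx | rfl | hx
  · simp [hx.ne, hx, toReal, abs_of_neg hx]
  · cases z <;> simp [toReal]
  · simp [hx.ne', hx.not_gt, toReal, abs_of_pos hx]

/-- The rounded magnitude is a variable `b` tied by an equation, so that once `mode` and `s` are
known it can be given as an explicit floor or ceiling and the equation closes by `rfl`. -/
theorem round_cases (mode : Rounding) (z : Bool) (x : ℝ) :
    ∃ s : Bool, (if s then x ≤ 0 else 0 ≤ x) ∧
      ∀ b, b = (mode.roundNat s (|x| / (2 : ℝ) ^ φ.ulpExp |x|) : ℝ) * (2 : ℝ) ^ φ.ulpExp |x| →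
        (round mode z x : Flt φ) = overflow mode s ∧ ¬ φ.IsMagnitude b ∨
          ∃ h : φ.IsMagnitude b, (round mode z x : Flt φ) = fin s b h := by
  refine ⟨if x = 0 then z else decide (x < 0), ?_, ?_⟩
  · rcases lt_trichotomy x 0 with hx | rfl | hx
    · simp [hx.ne, hx, hx.le]
    · simp
    · simp [hx.ne', hx.not_gt, hx.le]
  · rintro b rfl
    unfold round
    simp only
    generalize (if x = 0 then z else decide (x < 0)) = s
    split_ifs with h
    · exact .inr ⟨h, rfl⟩
    · exact .inl ⟨rfl, h⟩

theorem floor_mul_ulp_le (φ : FloatFormat) (x : ℝ) :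
    (⌊|x| / (2 : ℝ) ^ φ.ulpExp |x|⌋₊ : ℝ) * (2 : ℝ) ^ φ.ulpExp |x| ≤ |x| := by
  rw [← le_div_iff₀ (by positivity)]
  exact Nat.floor_le (by positivity)

theorem le_ceil_mul_ulp (φ : FloatFormat) (x : ℝ) :
    |x| ≤ (⌈|x| / (2 : ℝ) ^ φ.ulpExp |x|⌉₊ : ℝ) * (2 : ℝ) ^ φ.ulpExp |x| := by
  rw [← div_le_iff₀ (by positivity)]
  exact Nat.le_ceil _

/-- -∞ never occurs: a negative number that overflows upwards becomes the negative of `maxFinite`.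
The final clause, preservation of sign, keeps the computed 1 - g nonnegative in `geomTail_spec`. -/
theorem round_up_spec (z : Bool) (x : ℝ) :
    (round .up z x : Flt φ) = inf false ∧ 0 ≤ x ∨
      (round .up z x : Flt φ).IsFinite ∧ x ≤ (round .up z x : Flt φ).toReal ∧
        (x ≤ 0 → (round .up z x : Flt φ).toReal ≤ 0) := by
  obtain ⟨s, hs, hb⟩ := round_cases (φ := φ) .up z x
  have hfl := floor_mul_ulp_le φ x
  have hce := le_ceil_mul_ulp φ x
  cases s
  · have hx : 0 ≤ x := by simpa using hs
    rcases hb (⌈|x| / (2 : ℝ) ^ φ.ulpExp |x|⌉₊ * (2 : ℝ) ^ φ.ulpExp |x|) rfl with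
      ⟨h, -⟩ | ⟨hm, h⟩
    · exact .inl ⟨h, hx⟩
    · rw [h, toReal_fin_false]
      refine .inr ⟨trivial, (le_abs_self x).trans hce, fun h0 => ?_⟩
      simp [le_antisymm h0 hx]
  · have hx : x ≤ 0 := by simpa using hs
    right
    rcases hb (⌊|x| / (2 : ℝ) ^ φ.ulpExp |x|⌋₊ * (2 : ℝ) ^ φ.ulpExp |x|) rfl with
      ⟨h, hm⟩ | ⟨hm, h⟩
    -- Truncation fails only at magnitudes of at least `maxFinite`, so replacing x by the negative
    -- of `maxFinite` moves it upwards.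
    · have := FloatFormat.maxFinite_le_of_not_isMagnitude_floor (abs_nonneg x) hm
      rw [abs_of_nonpos hx] at this
      rw [h]
      change True ∧ x ≤ -φ.maxFinite ∧ (x ≤ 0 → -φ.maxFinite ≤ 0)
      exact ⟨trivial, by linarith, fun _ => by linarith [φ.maxFinite_nonneg]⟩
    · rw [h, toReal_fin_true]
      refine ⟨trivial, ?_, fun _ => by linarith [hm.nonneg]⟩
      have := abs_of_nonpos hx
      linarith

theorem round_down_spec (z : Bool) (x : ℝ) :
    (round .down z x : Flt φ) = inf true ∧ x ≤ 0 ∨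
      (round .down z x : Flt φ).IsFinite ∧ (round .down z x : Flt φ).toReal ≤ x ∧
        (0 ≤ x → 0 ≤ (round .down z x : Flt φ).toReal) := by
  obtain ⟨s, hs, hb⟩ := round_cases (φ := φ) .down z x
  have hfl := floor_mul_ulp_le φ x
  have hce := le_ceil_mul_ulp φ x
  cases s
  · have hx : 0 ≤ x := by simpa using hs
    right
    rcases hb (⌊|x| / (2 : ℝ) ^ φ.ulpExp |x|⌋₊ * (2 : ℝ) ^ φ.ulpExp |x|) rfl with
      ⟨h, hm⟩ | ⟨hm, h⟩
    · have := FloatFormat.maxFinite_le_of_not_isMagnitude_floor (abs_nonneg x) hm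
      rw [abs_of_nonneg hx] at this
      rw [h]
      exact ⟨trivial, this, fun _ => φ.maxFinite_nonneg⟩
    · rw [h, toReal_fin_false]
      exact ⟨trivial, hfl.trans (abs_of_nonneg hx).le, fun _ => hm.nonneg⟩
  · have hx : x ≤ 0 := by simpa using hs
    rcases hb (⌈|x| / (2 : ℝ) ^ φ.ulpExp |x|⌉₊ * (2 : ℝ) ^ φ.ulpExp |x|) rfl with
      ⟨h, -⟩ | ⟨hm, h⟩
    · exact .inl ⟨h, hx⟩
    · rw [h, toReal_fin_true]
      refine .inr ⟨trivial, ?_, fun h0 => ?_⟩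
      · have := abs_of_nonpos hx
        linarith
      · simp [le_antisymm hx h0]

theorem le_toReal_round_up {z : Bool} {x : ℝ} (h : (round .up z x : Flt φ).IsFinite) :
    x ≤ (round .up z x : Flt φ).toReal := by
  rcases round_up_spec (φ := φ) z x with ⟨h1, -⟩ | h1
  · rw [h1] at h
    exact h.elim
  · exact h1.2.1

theorem toReal_round_down_le {z : Bool} {x : ℝ} (h : (round .down z x : Flt φ).IsFinite) :
    (round .down z x : Flt φ).toReal ≤ x := by
  rcases round_down_spec (φ := φ) z x with ⟨h1, -⟩ | h1
  · rw [h1] at h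
    exact h.elim
  · exact h1.2.1

theorem round_up_ne (z : Bool) (x : ℝ) : (round .up z x : Flt φ) ≠ inf true := by
  intro h
  rcases round_up_spec (φ := φ) z x with ⟨h1, -⟩ | h1
  · rw [h1] at h
    simp at h
  · rw [h] at h1
    exact h1.1

theorem round_down_ne (z : Bool) (x : ℝ) : (round .down z x : Flt φ) ≠ inf false := by
  intro h
  rcases round_down_spec (φ := φ) z x with ⟨h1, -⟩ | h1
  · rw [h1] at h
    simp at h
  · rw [h] at h1
    exact h1.1

/-- The rounding of a positive number is not negative. -/
theorem round_toReal_nonneg (mode : Rounding) (z : Bool) {x : ℝ} (hx : 0 < x) :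
    0 ≤ (round mode z x : Flt φ).toReal := by
  obtain ⟨s, hs, hb⟩ := round_cases (φ := φ) mode z x
  cases s
  · rcases hb _ rfl with ⟨h, -⟩ | ⟨hm, h⟩
    · rw [h]
      cases mode
      · exact le_rfl
      · exact φ.maxFinite_nonneg
      · exact le_rfl
    · rw [h]
      exact hm.nonneg
  · exact absurd (by simpa using hs) hx.not_ge

theorem isFinite_zero : (zero : Flt φ).IsFinite := trivial

theorem toReal_zero : (zero : Flt φ).toReal = 0 := rfl

theorem isFinite_one : (one : Flt φ).IsFinite :=
  (round_of_isMagnitude _ _ (by simpa using φ.isMagnitude_one)).1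

theorem toReal_one : (one : Flt φ).toReal = 1 :=
  (round_of_isMagnitude _ _ (by simpa using φ.isMagnitude_one)).2

theorem isFinite_two : (two : Flt φ).IsFinite :=
  (round_of_isMagnitude _ _ (by simpa using φ.isMagnitude_two)).1

theorem toReal_two : (two : Flt φ).toReal = 2 :=
  (round_of_isMagnitude _ _ (by simpa using φ.isMagnitude_two)).2

/-! ## The operations -/

theorem isFinite_neg {a : Flt φ} : a.neg.IsFinite ↔ a.IsFinite := by
  cases a <;> rfl

theorem toReal_neg (a : Flt φ) : a.neg.toReal = -a.toReal := by
  match a with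
  | nan => simp [neg, toReal]
  | inf _ => simp [neg, toReal]
  | fin true _ _ => simp [neg, toReal]
  | fin false _ _ => simp [neg, toReal]

theorem isFinite_abs {a : Flt φ} : a.abs.IsFinite ↔ a.IsFinite := by
  cases a <;> rfl

theorem toReal_abs (a : Flt φ) : a.abs.toReal = |a.toReal| := by
  match a with
  | nan => simp [abs, toReal]
  | inf _ => simp [abs, toReal]
  | fin true _ h => simp [abs, toReal, abs_of_nonneg h.nonneg]
  | fin false _ h => simp [abs, toReal, abs_of_nonneg h.nonneg]

theorem abs_ne (a : Flt φ) : a.abs ≠ inf true := by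
  cases a <;> simp [abs]

theorem add_of_isFinite (m : Rounding) {a b : Flt φ} (ha : a.IsFinite) (hb : b.IsFinite) :
    ∃ z, add m a b = round m z (a.toReal + b.toReal) := by
  match a, b, ha, hb with
  | fin _ _ _, fin _ _ _, _, _ => exact ⟨_, rfl⟩

/-- Infinities and NaN are absorbing for finiteness. With its analogue for products, this lets a
single finiteness assumption on a final result reach all inputs. -/
theorem isFinite_of_add {m : Rounding} {a b : Flt φ} (h : (add m a b).IsFinite) :
    a.IsFinite ∧ b.IsFinite := by
  match a, b with
  | nan, _ => exact h.elim
  | inf _, nan => exact h.elim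
  | fin _ _ _, nan => exact h.elim
  | inf s, inf t =>
    simp only [add] at h
    split_ifs at h <;> exact h.elim
  | inf _, fin _ _ _ => exact h.elim
  | fin _ _ _, inf _ => exact h.elim
  | fin _ _ _, fin _ _ _ => exact ⟨trivial, trivial⟩

theorem add_up_spec {a b : Flt φ} (h : (add .up a b).IsFinite) :
    a.IsFinite ∧ b.IsFinite ∧ a.toReal + b.toReal ≤ (add .up a b).toReal := by
  obtain ⟨ha, hb⟩ := isFinite_of_add h
  obtain ⟨z, hz⟩ := add_of_isFinite .up ha hb
  rw [hz] at h ⊢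
  exact ⟨ha, hb, le_toReal_round_up h⟩

theorem add_down_spec {a b : Flt φ} (h : (add .down a b).IsFinite) :
    a.IsFinite ∧ b.IsFinite ∧ (add .down a b).toReal ≤ a.toReal + b.toReal := by
  obtain ⟨ha, hb⟩ := isFinite_of_add h
  obtain ⟨z, hz⟩ := add_of_isFinite .down ha hb
  rw [hz] at h ⊢
  exact ⟨ha, hb, toReal_round_down_le h⟩

theorem sub_up_spec {a b : Flt φ} (h : (sub .up a b).IsFinite) :
    a.IsFinite ∧ b.IsFinite ∧ a.toReal - b.toReal ≤ (sub .up a b).toReal := by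
  have := add_up_spec h
  rwa [isFinite_neg, toReal_neg, ← sub_eq_add_neg] at this

theorem sub_down_spec {a b : Flt φ} (h : (sub .down a b).IsFinite) :
    a.IsFinite ∧ b.IsFinite ∧ (sub .down a b).toReal ≤ a.toReal - b.toReal := by
  have := add_down_spec h
  rwa [isFinite_neg, toReal_neg, ← sub_eq_add_neg] at this

theorem sub_of_isFinite (m : Rounding) {a b : Flt φ} (ha : a.IsFinite) (hb : b.IsFinite) :
    ∃ z, sub m a b = round m z (a.toReal - b.toReal) := by
  have := add_of_isFinite m ha (isFinite_neg.2 hb)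
  rwa [toReal_neg, ← sub_eq_add_neg] at this

/-- -∞ satisfies every upper bound test, so it has to be excluded from the row sums of `normInf`
before the comparison with 1 says anything. -/
theorem add_up_ne {a b : Flt φ} (ha : a ≠ inf true) (hb : b ≠ inf true) :
    add .up a b ≠ inf true := by
  match a, b with
  | nan, _ => simp [add]
  | inf _, nan => simp [add]
  | fin _ _ _, nan => simp [add]
  | inf s, inf t =>
    simp only [add]
    split_ifs
    · exact ha
    · simp
  | inf _, fin _ _ _ => exact ha
  | fin _ _ _, inf _ => exact hb
  | fin _ _ _, fin _ _ _ => exact round_up_ne _ _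

theorem mul_of_isFinite (m : Rounding) {a b : Flt φ} (ha : a.IsFinite) (hb : b.IsFinite) :
    ∃ z, mul m a b = round m z (a.toReal * b.toReal) := by
  match a, b, ha, hb with
  | fin _ _ _, fin _ _ _, _, _ => exact ⟨_, rfl⟩

theorem isFinite_of_mul {m : Rounding} {a b : Flt φ} (h : (mul m a b).IsFinite) :
    a.IsFinite ∧ b.IsFinite := by
  match a, b with
  | nan, _ => exact h.elim
  | inf _, nan => exact h.elim
  | fin _ _ _, nan => exact h.elim
  | inf s, inf t => exact h.elim
  | inf _, fin _ _ _ =>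
    simp only [mul] at h
    split_ifs at h <;> exact h.elim
  | fin _ _ _, inf _ =>
    simp only [mul] at h
    split_ifs at h <;> exact h.elim
  | fin _ _ _, fin _ _ _ => exact ⟨trivial, trivial⟩

theorem mul_up_spec {a b : Flt φ} (h : (mul .up a b).IsFinite) :
    a.IsFinite ∧ b.IsFinite ∧ a.toReal * b.toReal ≤ (mul .up a b).toReal := by
  obtain ⟨ha, hb⟩ := isFinite_of_mul h
  obtain ⟨z, hz⟩ := mul_of_isFinite .up ha hb
  rw [hz] at h ⊢
  exact ⟨ha, hb, le_toReal_round_up h⟩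

theorem mul_down_spec {a b : Flt φ} (h : (mul .down a b).IsFinite) :
    a.IsFinite ∧ b.IsFinite ∧ (mul .down a b).toReal ≤ a.toReal * b.toReal := by
  obtain ⟨ha, hb⟩ := isFinite_of_mul h
  obtain ⟨z, hz⟩ := mul_of_isFinite .down ha hb
  rw [hz] at h ⊢
  exact ⟨ha, hb, toReal_round_down_le h⟩

/-- Only the numerator is covered: a finite number divided by an infinity is a zero. Finiteness of
denominators must come from elsewhere. -/
theorem isFinite_left_of_div {m : Rounding} {a b : Flt φ} (h : (div m a b).IsFinite) :
    a.IsFinite := by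
  match a, b with
  | nan, _ => exact h.elim
  | inf _, nan => exact h.elim
  | inf _, inf _ => exact h.elim
  | inf _, fin _ _ _ => exact h.elim
  | fin _ _ _, _ => trivial

theorem div_of_isFinite (m : Rounding) {a b : Flt φ} (ha : a.IsFinite) (hb : b.IsFinite)
    (h0 : b.toReal ≠ 0) : ∃ z, div m a b = round m z (a.toReal / b.toReal) := by
  match a, b, ha, hb with
  | fin _ _ _, fin t y hy, _, _ =>
    have : y ≠ 0 := by
      rintro rfl
      cases t <;> simp [toReal] at h0
    exact ⟨_, if_neg this⟩

theorem toReal_ne_zero_of_div {m : Rounding} {a b : Flt φ} (hb : b.IsFinite)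
    (h : (div m a b).IsFinite) : b.toReal ≠ 0 := by
  intro h0
  match a, b, hb with
  | nan, _, _ => exact h.elim
  | inf _, fin _ _ _, _ => exact h.elim
  | fin s x hx, fin t y hy, _ =>
    have hy0 : y = 0 := by
      cases t <;> simpa [toReal] using h0
    simp only [div, hy0, if_true] at h
    split_ifs at h <;> exact h.elim

theorem div_up_spec {a b : Flt φ} (hb : b.IsFinite) (h : (div .up a b).IsFinite) :
    a.IsFinite ∧ b.toReal ≠ 0 ∧ a.toReal / b.toReal ≤ (div .up a b).toReal := by
  have ha := isFinite_left_of_div h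
  have h0 := toReal_ne_zero_of_div hb h
  obtain ⟨z, hz⟩ := div_of_isFinite .up ha hb h0
  rw [hz] at h ⊢
  exact ⟨ha, h0, le_toReal_round_up h⟩

/-- The root of -0 is -0, whose real value is still nonnegative. This yields the sign of the
diagonal of the computed triangular factor. -/
theorem sqrt_spec {m : Rounding} {a : Flt φ} (h : (sqrt m a).IsFinite) :
    a.IsFinite ∧ 0 ≤ a.toReal ∧ 0 ≤ (sqrt m a).toReal := by
  match a with
  | nan => exact h.elim
  | inf true => exact h.elim
  | inf false => exact h.elim
  | fin s x hx =>
    simp only [sqrt] at h ⊢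
    split_ifs with h0 hs
    · subst h0
      cases s <;> simp [toReal, IsFinite]
    · rw [if_neg h0, if_pos hs] at h
      exact h.elim
    · have : s = false := by simpa using hs
      subst this
      exact ⟨trivial, hx.nonneg,
        round_toReal_nonneg _ _ (Real.sqrt_pos.2 (lt_of_le_of_ne hx.nonneg (Ne.symm h0)))⟩

theorem sqrt_up_spec {a : Flt φ} (h : (sqrt .up a).IsFinite) :
    Real.sqrt a.toReal ≤ (sqrt .up a).toReal := by
  match a with
  | nan => exact h.elim
  | inf true => exact h.elim
  | inf false => exact h.elim
  | fin s x hx =>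
    simp only [sqrt] at h ⊢
    split_ifs with h0 hs
    · subst h0
      cases s <;> simp [toReal]
    · rw [if_neg h0, if_pos hs] at h
      exact h.elim
    · rw [if_neg h0, if_neg hs] at h
      have : s = false := by simpa using hs
      subst this
      exact le_toReal_round_up h

theorem leB_eq_true {a b : Flt φ} :
    leB a b = true ↔ ¬ a.IsNaN ∧ ¬ b.IsNaN ∧ a.toEReal ≤ b.toEReal := by
  simp [leB]

theorem ltB_eq_true {a b : Flt φ} :
    ltB a b = true ↔ ¬ a.IsNaN ∧ ¬ b.IsNaN ∧ a.toEReal < b.toEReal := by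
  simp [ltB]

theorem IsFinite.leB_iff {a b : Flt φ} (ha : a.IsFinite) (hb : b.IsFinite) :
    leB a b = true ↔ a.toReal ≤ b.toReal := by
  rw [leB_eq_true, ha.toEReal_eq, hb.toEReal_eq, EReal.coe_le_coe_iff]
  exact ⟨fun h => h.2.2, fun h => ⟨ha.not_isNaN, hb.not_isNaN, h⟩⟩

theorem max_spec {a b : Flt φ} (h : ¬ (max a b).IsNaN) :
    ¬ a.IsNaN ∧ ¬ b.IsNaN ∧ a.toEReal ≤ (max a b).toEReal ∧ b.toEReal ≤ (max a b).toEReal ∧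
      (max a b = a ∨ max a b = b) := by
  unfold max at h ⊢
  split_ifs at h ⊢ with h1 h2
  · exact absurd trivial h
  · rw [not_or] at h1
    exact ⟨h1.1, h1.2, (leB_eq_true.1 h2).2.2, le_rfl, .inr rfl⟩
  · rw [not_or] at h1
    refine ⟨h1.1, h1.2, le_rfl, ?_, .inl rfl⟩
    rw [leB_eq_true] at h2
    by_contra! h3
    exact h2 ⟨h1.1, h1.2, h3.le⟩

theorem isFinite_of_toEReal_le {a b : Flt φ} (ha : ¬ a.IsNaN) (ha' : a ≠ inf true)
    (hb : b.IsFinite) (h : a.toEReal ≤ b.toEReal) : a.IsFinite ∧ a.toReal ≤ b.toReal := by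
  have hf : a.IsFinite := by
    refine isFinite_of_ne ha ha' ?_
    rintro rfl
    rw [hb.toEReal_eq] at h
    exact absurd h (not_le.2 (EReal.coe_lt_top _))
  refine ⟨hf, ?_⟩
  rwa [hf.toEReal_eq, hb.toEReal_eq, EReal.coe_le_coe_iff] at h

theorem ofReal_up_spec {x : ℝ} (h : (ofReal .up x : Flt φ).IsFinite) :
    x ≤ (ofReal .up x : Flt φ).toReal := le_toReal_round_up h

theorem ofReal_down_spec {x : ℝ} (h : (ofReal .down x : Flt φ).IsFinite) :
    (ofReal .down x : Flt φ).toReal ≤ x := toReal_round_down_le h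

end Flt

/-! ## Values and finiteness in counted computations -/

namespace Counted

theorem bind_val {α β : Type} (x : Counted α) (f : α → Counted β) :
    (x >>= f).val = (f x.val).val := rfl

theorem bind_ops {α β : Type} (x : Counted α) (f : α → Counted β) :
    (x >>= f).ops = x.ops + (f x.val).ops := rfl

theorem pure_val {α : Type} (a : α) : (pure a : Counted α).val = a := rfl

theorem pure_ops {α : Type} (a : α) : (pure a : Counted α).ops = 0 := rfl

theorem vec_val {n : ℕ} {α : Type} (f : Fin n → Counted α) :
    (vec f).val = fun i => (f i).val := rfl

theorem vec_ops {n : ℕ} {α : Type} (f : Fin n → Counted α) :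
    (vec f).ops = ∑ i, (f i).ops := rfl

theorem mat_val {n : ℕ} {α : Type} (f : Fin n → Fin n → Counted α) :
    (mat f).val = fun i j => (f i j).val := rfl

theorem mat_ops {n : ℕ} {α : Type} (f : Fin n → Fin n → Counted α) :
    (mat f).ops = ∑ i, ∑ j, (f i j).ops := rfl

theorem ite_val {α : Type} (P : Prop) [Decidable P] (x y : Counted α) :
    (if P then x else y).val = if P then x.val else y.val := by
  split_ifs <;> rfl

theorem ite_ops {α : Type} (P : Prop) [Decidable P] (x y : Counted α) :
    (if P then x else y).ops = if P then x.ops else y.ops := by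
  split_ifs <;> rfl

theorem foldlM_val {α β : Type} (f : β → α → Counted β) (l : List α) (b : β) :
    (l.foldlM f b).val = l.foldl (fun b a => (f b a).val) b := by
  induction l generalizing b with
  | nil => rfl
  | cons a l ih =>
    rw [List.foldlM_cons, bind_val, ih]
    rfl

/-- The cost of an iteration may depend on the index but not on the accumulator, which makes all
operation counts independent of the data. -/
theorem foldlM_ops {α β : Type} (f : β → α → Counted β) (c : α → ℕ)
    (hf : ∀ b a, (f b a).ops = c a) (l : List α) (b : β) :
    (l.foldlM f b).ops = (l.map c).sum := by
  induction l generalizing b with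
  | nil => rfl
  | cons a l ih =>
    rw [List.foldlM_cons, bind_ops, ih, hf, List.map_cons, List.sum_cons]

/-- An invariant of a loop. -/
theorem foldlM_induction {α β : Type} (P : β → Prop) (f : β → α → Counted β)
    (hf : ∀ b a, P b → P (f b a).val) (l : List α) (b : β) (hb : P b) :
    P (l.foldlM f b).val := by
  induction l generalizing b with
  | nil => exact hb
  | cons a l ih => exact ih _ (hf b a hb)

end Counted

/-! ### Rounding analysis of inner products, norms, geometric tails and Gram bounds. -/

namespace LLLCertificate

open Counted

variable {φ : FloatFormat} {n : ℕ}

theorem nodup_idx (P : Fin n → Prop) [DecidablePred P] : (idx P).Nodup :=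
  (List.nodup_finRange n).filter _

theorem toFinset_idx (P : Fin n → Prop) [DecidablePred P] :
    (idx P).toFinset = Finset.univ.filter P := by
  ext k
  simp [idx]

theorem mem_idx {P : Fin n → Prop} [DecidablePred P] {k : Fin n} : k ∈ idx P ↔ P k := by
  simp [idx]

theorem upperMat_val (f : Fin n → Fin n → Counted (Flt φ)) (i j : Fin n) :
    (upperMat f).val i j = if i ≤ j then (f i j).val else Flt.zero := by
  unfold upperMat
  rw [mat_val]
  simp only [ite_val, pure_val]

theorem symMat_val (f : Fin n → Fin n → Counted (Flt φ)) (i j : Fin n) :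
    (symMat f).val i j = if i ≤ j then (f i j).val else (f j i).val := by
  change (if i ≤ j then (upperMat f).val i j else (upperMat f).val j i) = _
  simp only [upperMat_val]
  split_ifs with h h'
  · rfl
  · rfl
  · exact absurd (le_of_not_ge h) h'

theorem dot_val (m : Rounding) (l : List (Fin n)) (f g : Fin n → Flt φ) :
    (dot m l f g).val =
      l.foldl (fun acc k => Flt.add m acc (Flt.mul m (f k) (g k))) Flt.zero := by
  unfold dot
  rw [foldlM_val]
  rfl

theorem foldl_mul_add_up {l : List (Fin n)} {f g : Fin n → Flt φ} {a : Flt φ}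
    (h : (l.foldl (fun acc k => Flt.add .up acc (Flt.mul .up (f k) (g k))) a).IsFinite) :
    a.IsFinite ∧ (∀ k ∈ l, (f k).IsFinite ∧ (g k).IsFinite) ∧
      a.toReal + (l.map fun k => (f k).toReal * (g k).toReal).sum ≤
        (l.foldl (fun acc k => Flt.add .up acc (Flt.mul .up (f k) (g k))) a).toReal := by
  induction l generalizing a with
  | nil => simpa using h
  | cons k l ih =>
    obtain ⟨h1, h2, h3⟩ := ih h
    obtain ⟨ha, hm, h4⟩ := Flt.add_up_spec h1
    obtain ⟨hf, hg, h5⟩ := Flt.mul_up_spec hm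
    refine ⟨ha, List.forall_mem_cons.2 ⟨⟨hf, hg⟩, h2⟩, ?_⟩
    rw [List.map_cons, List.sum_cons, List.foldl_cons]
    linarith

theorem foldl_mul_add_down {l : List (Fin n)} {f g : Fin n → Flt φ} {a : Flt φ}
    (h : (l.foldl (fun acc k => Flt.add .down acc (Flt.mul .down (f k) (g k))) a).IsFinite) :
    a.IsFinite ∧ (∀ k ∈ l, (f k).IsFinite ∧ (g k).IsFinite) ∧
      (l.foldl (fun acc k => Flt.add .down acc (Flt.mul .down (f k) (g k))) a).toReal ≤
        a.toReal + (l.map fun k => (f k).toReal * (g k).toReal).sum := by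
  induction l generalizing a with
  | nil => simpa using h
  | cons k l ih =>
    obtain ⟨h1, h2, h3⟩ := ih h
    obtain ⟨ha, hm, h4⟩ := Flt.add_down_spec h1
    obtain ⟨hf, hg, h5⟩ := Flt.mul_down_spec hm
    refine ⟨ha, List.forall_mem_cons.2 ⟨⟨hf, hg⟩, h2⟩, ?_⟩
    rw [List.map_cons, List.sum_cons, List.foldl_cons]
    linarith

theorem dot_up_spec {l : List (Fin n)} (hl : l.Nodup) {f g : Fin n → Flt φ}
    (h : (dot .up l f g).val.IsFinite) :
    (∀ k ∈ l, (f k).IsFinite ∧ (g k).IsFinite) ∧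
      ∑ k ∈ l.toFinset, (f k).toReal * (g k).toReal ≤ (dot .up l f g).val.toReal := by
  rw [dot_val] at h ⊢
  obtain ⟨-, h1, h2⟩ := foldl_mul_add_up h
  rw [Flt.toReal_zero, zero_add] at h2
  rw [List.sum_toFinset _ hl]
  exact ⟨h1, h2⟩

theorem dot_down_spec {l : List (Fin n)} (hl : l.Nodup) {f g : Fin n → Flt φ}
    (h : (dot .down l f g).val.IsFinite) :
    (∀ k ∈ l, (f k).IsFinite ∧ (g k).IsFinite) ∧
      (dot .down l f g).val.toReal ≤ ∑ k ∈ l.toFinset, (f k).toReal * (g k).toReal := by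
  rw [dot_val] at h ⊢
  obtain ⟨-, h1, h2⟩ := foldl_mul_add_down h
  rw [Flt.toReal_zero, zero_add] at h2
  rw [List.sum_toFinset _ hl]
  exact ⟨h1, h2⟩

theorem dot_idx_up_spec {P : Fin n → Prop} [DecidablePred P] {f g : Fin n → Flt φ}
    (h : (dot .up (idx P) f g).val.IsFinite) :
    (∀ k, P k → (f k).IsFinite ∧ (g k).IsFinite) ∧
      ∑ k with P k, (f k).toReal * (g k).toReal ≤ (dot .up (idx P) f g).val.toReal := by
  obtain ⟨h1, h2⟩ := dot_up_spec (nodup_idx P) h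
  rw [toFinset_idx] at h2
  exact ⟨fun k hk => h1 k (mem_idx.2 hk), h2⟩

theorem dot_idx_down_spec {P : Fin n → Prop} [DecidablePred P] {f g : Fin n → Flt φ}
    (h : (dot .down (idx P) f g).val.IsFinite) :
    (∀ k, P k → (f k).IsFinite ∧ (g k).IsFinite) ∧
      (dot .down (idx P) f g).val.toReal ≤ ∑ k with P k, (f k).toReal * (g k).toReal := by
  obtain ⟨h1, h2⟩ := dot_down_spec (nodup_idx P) h
  rw [toFinset_idx] at h2
  exact ⟨fun k hk => h1 k (mem_idx.2 hk), h2⟩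

theorem toReal_idEntry (i j : Fin n) :
    (idEntry i j : Flt φ).toReal = (1 : Matrix (Fin n) (Fin n) ℝ) i j := by
  unfold idEntry
  rw [Matrix.one_apply]
  split_ifs
  · exact Flt.toReal_one
  · exact Flt.toReal_zero

theorem toReal_twoIdEntry (i j : Fin n) :
    (twoIdEntry i j : Flt φ).toReal = (2 : Matrix (Fin n) (Fin n) ℝ) i j := by
  unfold twoIdEntry
  rw [← Nat.cast_ofNat, Matrix.natCast_apply]
  split_ifs
  · simpa using Flt.toReal_two
  · simpa using Flt.toReal_zero

theorem absSubBound_val (lo hi c : Flt φ) :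
    (absSubBound lo hi c).val =
      Flt.max (Flt.sub .down lo c).abs (Flt.sub .up hi c).abs := rfl

theorem absSubBound_ne (lo hi c : Flt φ) : (absSubBound lo hi c).val ≠ Flt.inf true := by
  rw [absSubBound_val]
  intro h
  have h0 : ¬ (Flt.max (Flt.sub .down lo c).abs (Flt.sub .up hi c).abs).IsNaN := by
    rw [h]
    exact id
  rcases (Flt.max_spec h0).2.2.2.2 with h1 | h1 <;> exact Flt.abs_ne _ (h1.symm.trans h)

/-- The computed differences enclose x - c from below and from above, so the larger of their
absolute values dominates it. -/
theorem absSubBound_spec {lo hi c : Flt φ} (h : (absSubBound lo hi c).val.IsFinite) :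
    lo.IsFinite ∧ hi.IsFinite ∧ ∀ x : ℝ, lo.toReal ≤ x → x ≤ hi.toReal →
      |x - c.toReal| ≤ (absSubBound lo hi c).val.toReal := by
  rw [absSubBound_val] at h ⊢
  obtain ⟨h1, h2, h3, h4, -⟩ := Flt.max_spec h.not_isNaN
  obtain ⟨h5, h6⟩ := Flt.isFinite_of_toEReal_le h1 (Flt.abs_ne _) h h3
  obtain ⟨h7, h8⟩ := Flt.isFinite_of_toEReal_le h2 (Flt.abs_ne _) h h4
  rw [Flt.isFinite_abs] at h5 h7
  rw [Flt.toReal_abs] at h6 h8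
  obtain ⟨hlo, -, h9⟩ := Flt.sub_down_spec h5
  obtain ⟨hhi, -, h10⟩ := Flt.sub_up_spec h7
  refine ⟨hlo, hhi, fun x hx1 hx2 => abs_le.2 ⟨?_, ?_⟩⟩
  · have := neg_abs_le (Flt.sub .down lo c).toReal
    linarith
  · have := le_abs_self (Flt.sub .up hi c).toReal
    linarith

theorem foldl_add_up_ne {l : List (Fin n)} {f : Fin n → Flt φ} {a : Flt φ}
    (ha : a ≠ Flt.inf true) (hf : ∀ k ∈ l, f k ≠ Flt.inf true) :
    l.foldl (fun acc k => Flt.add .up acc (f k)) a ≠ Flt.inf true := by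
  induction l generalizing a with
  | nil => exact ha
  | cons k l ih =>
    exact ih (Flt.add_up_ne ha (hf k List.mem_cons_self))
      fun k hk => hf k (List.mem_cons_of_mem _ hk)

theorem foldl_add_up_spec {l : List (Fin n)} {f : Fin n → Flt φ} {a : Flt φ}
    (h : (l.foldl (fun acc k => Flt.add .up acc (f k)) a).IsFinite) :
    a.IsFinite ∧ (∀ k ∈ l, (f k).IsFinite) ∧ a.toReal + (l.map fun k => (f k).toReal).sum ≤
      (l.foldl (fun acc k => Flt.add .up acc (f k)) a).toReal := by
  induction l generalizing a with
  | nil => simpa using h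
  | cons k l ih =>
    obtain ⟨h1, h2, h3⟩ := ih h
    obtain ⟨ha, hf, h4⟩ := Flt.add_up_spec h1
    refine ⟨ha, List.forall_mem_cons.2 ⟨hf, h2⟩, ?_⟩
    rw [List.map_cons, List.sum_cons, List.foldl_cons]
    linarith

theorem foldl_max_spec {l : List (Fin n)} {f : Fin n → Flt φ} {a : Flt φ}
    (h : ¬ (l.foldl (fun acc k => Flt.max acc (f k)) a).IsNaN) :
    ¬ a.IsNaN ∧ a.toEReal ≤ (l.foldl (fun acc k => Flt.max acc (f k)) a).toEReal ∧
      ∀ k ∈ l, ¬ (f k).IsNaN ∧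
        (f k).toEReal ≤ (l.foldl (fun acc k => Flt.max acc (f k)) a).toEReal := by
  induction l generalizing a with
  | nil => simpa using h
  | cons k l ih =>
    obtain ⟨h1, h2, h3⟩ := ih h
    obtain ⟨h4, h5, h6, h7, -⟩ := Flt.max_spec h1
    exact ⟨h4, h6.trans h2, List.forall_mem_cons.2 ⟨⟨h5, h7.trans h2⟩, h3⟩⟩

theorem normInf_val (M : FMat φ n) :
    (normInf M).val = (List.finRange n).foldl (fun acc i => Flt.max acc
      ((List.finRange n).foldl (fun acc j => Flt.add .up acc (M i j)) Flt.zero)) Flt.zero := by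
  unfold normInf
  simp only [bind_val, vec_val, foldlM_val]
  rfl

/-- A successful comparison with 1 excludes NaN and +∞, and the initial value 0 of the maximum
excludes -∞ for the norm. The hypothesis `hM` excludes -∞ for the row sums; they are then finite,
and so are all entries. -/
theorem normInf_spec {M : FMat φ n} (hM : ∀ i j, M i j ≠ Flt.inf true)
    (h : Flt.ltB (normInf M).val Flt.one = true) :
    (normInf M).val.IsFinite ∧ 0 ≤ (normInf M).val.toReal ∧ (normInf M).val.toReal < 1 ∧
      ∀ i, (∀ j, (M i j).IsFinite) ∧ ∑ j, (M i j).toReal ≤ (normInf M).val.toReal := by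
  obtain ⟨h1, -, h2⟩ := Flt.ltB_eq_true.1 h
  rw [Flt.isFinite_one.toEReal_eq, Flt.toReal_one] at h2
  rw [normInf_val] at h1 h2 ⊢
  obtain ⟨-, h3, h4⟩ := foldl_max_spec h1
  set r := (List.finRange n).foldl (fun acc i => Flt.max acc
      ((List.finRange n).foldl (fun acc j => Flt.add .up acc (M i j)) Flt.zero)) Flt.zero
  rw [Flt.isFinite_zero.toEReal_eq, Flt.toReal_zero] at h3
  have hr : r.IsFinite := by
    refine Flt.isFinite_of_ne h1 ?_ ?_
    · intro h0
      rw [h0] at h3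
      exact absurd h3 (not_le.2 (EReal.bot_lt_coe _))
    · intro h0
      rw [h0] at h2
      exact absurd h2 (not_lt.2 le_top)
  rw [hr.toEReal_eq] at h2 h3
  refine ⟨hr, EReal.coe_le_coe_iff.1 h3, EReal.coe_lt_coe_iff.1 h2, fun i => ?_⟩
  obtain ⟨h5, h6⟩ := h4 i (List.mem_finRange i)
  obtain ⟨h7, h8⟩ := Flt.isFinite_of_toEReal_le h5
    (foldl_add_up_ne (by simp [Flt.zero]) fun j _ => hM i j) hr h6
  obtain ⟨-, h9, h10⟩ := foldl_add_up_spec h7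
  refine ⟨fun j => h9 j (List.mem_finRange j), ?_⟩
  rw [Flt.toReal_zero, zero_add] at h10
  rw [← List.sum_toFinset _ (List.nodup_finRange n), List.toFinset_finRange] at h10
  exact h10.trans h8

theorem geomTail_val (g : Flt φ) :
    (geomTail g).val = Flt.div .up (Flt.mul .up g g) (Flt.sub .up g Flt.one).neg := rfl

/-- The negative of g - 1 rounded up is a lower bound for 1 - g. It is nonnegative by preservation
of sign, and nonzero because the quotient is finite, so dividing by it errs upwards. -/
theorem geomTail_spec {g : Flt φ} (hg : g.IsFinite) (h1 : g.toReal < 1)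
    (h : (geomTail g).val.IsFinite) :
    g.toReal ^ 2 / (1 - g.toReal) ≤ (geomTail g).val.toReal := by
  rw [geomTail_val] at h ⊢
  obtain ⟨z, hz⟩ := Flt.sub_of_isFinite .up hg (Flt.isFinite_one (φ := φ))
  rw [Flt.toReal_one] at hz
  obtain ⟨hd, hd1, hd2⟩ : (Flt.sub .up g Flt.one).IsFinite ∧
      g.toReal - 1 ≤ (Flt.sub .up g Flt.one).toReal ∧ (Flt.sub .up g Flt.one).toReal ≤ 0 := by
    rcases Flt.round_up_spec (φ := φ) z (g.toReal - 1) with ⟨-, h2⟩ | ⟨h2, h3, h4⟩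
    · linarith
    · rw [hz]
      exact ⟨h2, h3, h4 (by linarith)⟩
  obtain ⟨hs, hd0, h2⟩ := Flt.div_up_spec (Flt.isFinite_neg.2 hd) h
  obtain ⟨-, -, h3⟩ := Flt.mul_up_spec hs
  rw [Flt.toReal_neg] at h2 hd0
  have hpos : 0 < -(Flt.sub .up g Flt.one).toReal := by
    refine lt_of_le_of_ne (by linarith) (Ne.symm hd0)
  refine le_trans ?_ h2
  have : g.toReal ^ 2 ≤ (Flt.mul .up g g).toReal := by rwa [sq]
  exact div_le_div₀ ((sq_nonneg _).trans this) this hpos (by linarith)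

/-- The midpoint-radius form of an interval. -/
theorem midRad_spec {lo hi : Flt φ}
    (h : (Flt.sub .up (Flt.add .up lo (Flt.div .up (Flt.sub .up hi lo) Flt.two)) lo).IsFinite) :
    lo.IsFinite ∧ hi.IsFinite ∧ ∀ x : ℝ, lo.toReal ≤ x → x ≤ hi.toReal →
      |x - (Flt.add .up lo (Flt.div .up (Flt.sub .up hi lo) Flt.two)).toReal| ≤
        (Flt.sub .up (Flt.add .up lo (Flt.div .up (Flt.sub .up hi lo) Flt.two)) lo).toReal := by
  obtain ⟨h1, -, h2⟩ := Flt.sub_up_spec h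
  obtain ⟨hlo, h3, h4⟩ := Flt.add_up_spec h1
  obtain ⟨h5, -, h6⟩ := Flt.div_up_spec Flt.isFinite_two h3
  obtain ⟨hhi, -, h7⟩ := Flt.sub_up_spec h5
  rw [Flt.toReal_two] at h6
  -- Rounding up gives mid ≥ (lo + hi)/2, hence hi - mid ≤ mid - lo ≤ rad: the left half of the
  -- interval decides the radius.
  refine ⟨hlo, hhi, fun x hx1 hx2 => abs_le.2 ⟨?_, ?_⟩⟩ <;> linarith

/-- With X = M + E, where |E| ≤ rad, each summand splits as m m' + m e' + e x'. The first sum is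
enclosed by the two directed inner products; the others are bounded by |m| rad' and rad (|m'| +
rad'). The enclosure `hX` is required only at finite endpoints, since infinite ones carry no real
value. -/
theorem gramBound_spec {K : Fin n → List (Fin n)} (hK : ∀ i, (K i).Nodup) {Xlo Xhi : FMat φ n}
    {X : Matrix (Fin n) (Fin n) ℝ}
    (hX : ∀ i j, (Xlo i j).IsFinite → (Xhi i j).IsFinite →
      (Xlo i j).toReal ≤ X i j ∧ X i j ≤ (Xhi i j).toReal)
    {i j : Fin n} (hij : i ≤ j) (h : ((gramBound K Xlo Xhi).val i j).IsFinite) :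
    |∑ k ∈ (K i).toFinset, X k i * X k j - (1 : Matrix (Fin n) (Fin n) ℝ) i j| ≤
      ((gramBound K Xlo Xhi).val i j).toReal := by
  obtain ⟨mid, hmid⟩ : ∃ mid : FMat φ n, mid = fun i j =>
    Flt.add .up (Xlo i j) (Flt.div .up (Flt.sub .up (Xhi i j) (Xlo i j)) Flt.two) := ⟨_, rfl⟩
  obtain ⟨rad, hrad⟩ : ∃ rad : FMat φ n, rad = fun i j =>
    Flt.sub .up (mid i j) (Xlo i j) := ⟨_, rfl⟩
  have hval : (gramBound K Xlo Xhi).val i j =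
      Flt.add .up (Flt.add .up
        (absSubBound (dot .down (K i) (fun k => mid k i) (fun k => mid k j)).val
          (dot .up (K i) (fun k => mid k i) (fun k => mid k j)).val (idEntry i j)).val
        (dot .up (K i) (fun k => (mid k i).abs) (fun k => rad k j)).val)
        (dot .up (K i) (fun k => rad k i)
          (fun k => Flt.add .up (mid k j).abs (rad k j))).val := by
    have : (gramBound K Xlo Xhi).val i j = (symMat (fun i j => do
        let lo ← dot .down (K i) (fun k => mid k i) (fun k => mid k j)
        let hi ← dot .up (K i) (fun k => mid k i) (fun k => mid k j)
        let c ← absSubBound lo hi (idEntry i j)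
        let p ← dot .up (K i) (fun k => (mid k i).abs) (fun k => rad k j)
        let q ← dot .up (K i) (fun k => rad k i)
          (fun k => Flt.add .up (mid k j).abs (rad k j))
        let c ← add .up c p
        add .up c q)).val i j := by
      subst hrad hmid
      rfl
    rw [this, symMat_val, if_pos hij]
    rfl
  have hrX : ∀ k l, (rad k l).IsFinite → |X k l - (mid k l).toReal| ≤ (rad k l).toReal := by
    intro k l hr
    rw [hrad, hmid] at hr
    obtain ⟨h1, h2, h3⟩ := midRad_spec hr
    obtain ⟨h4, h5⟩ := hX k l h1 h2
    rw [hrad, hmid]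
    exact h3 _ h4 h5
  rw [hval] at h ⊢
  obtain ⟨h1, h2, h3⟩ := Flt.add_up_spec h
  obtain ⟨h4, h5, h6⟩ := Flt.add_up_spec h1
  obtain ⟨h7, h8, h9⟩ := absSubBound_spec h4
  obtain ⟨-, h10⟩ := dot_down_spec (hK i) h7
  obtain ⟨-, h11⟩ := dot_up_spec (hK i) h8
  obtain ⟨h12, h13⟩ := dot_up_spec (hK i) h5
  obtain ⟨h14, h15⟩ := dot_up_spec (hK i) h2
  have h16 := h9 _ h10 h11
  rw [toReal_idEntry] at h16
  have hsplit : ∑ k ∈ (K i).toFinset, X k i * X k j =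
      ∑ k ∈ (K i).toFinset, (mid k i).toReal * (mid k j).toReal +
        ∑ k ∈ (K i).toFinset, (mid k i).toReal * (X k j - (mid k j).toReal) +
        ∑ k ∈ (K i).toFinset, (X k i - (mid k i).toReal) * X k j := by
    rw [← Finset.sum_add_distrib, ← Finset.sum_add_distrib]
    exact Finset.sum_congr rfl fun k _ => by ring
  have h17 : |∑ k ∈ (K i).toFinset, (mid k i).toReal * (X k j - (mid k j).toReal)| ≤
      ∑ k ∈ (K i).toFinset, ((mid k i).abs).toReal * (rad k j).toReal := by
    refine (Finset.abs_sum_le_sum_abs _ _).trans (Finset.sum_le_sum fun k hk => ?_)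
    rw [abs_mul, Flt.toReal_abs]
    exact mul_le_mul_of_nonneg_left (hrX _ _ (h12 k (List.mem_toFinset.1 hk)).2) (abs_nonneg _)
  have h18 : |∑ k ∈ (K i).toFinset, (X k i - (mid k i).toReal) * X k j| ≤
      ∑ k ∈ (K i).toFinset, (rad k i).toReal *
        (Flt.add .up (mid k j).abs (rad k j)).toReal := by
    refine (Finset.abs_sum_le_sum_abs _ _).trans (Finset.sum_le_sum fun k hk => ?_)
    obtain ⟨h19, h20⟩ := h14 k (List.mem_toFinset.1 hk)
    obtain ⟨-, h21, h22⟩ := Flt.add_up_spec h20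
    rw [Flt.toReal_abs] at h22
    rw [abs_mul]
    have h23 := hrX _ _ h21
    have h24 := hrX _ _ h19
    refine mul_le_mul h24 ?_ (abs_nonneg _) ((abs_nonneg _).trans h24)
    have := abs_sub_abs_le_abs_sub (X k j) (mid k j).toReal
    linarith
  rw [hsplit]
  set a := ∑ k ∈ (K i).toFinset, (mid k i).toReal * (mid k j).toReal
  set b := ∑ k ∈ (K i).toFinset, (mid k i).toReal * (X k j - (mid k j).toReal)
  set c := ∑ k ∈ (K i).toFinset, (X k i - (mid k i).toReal) * X k j
  rw [abs_le] at h16 h17 h18 ⊢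
  constructor <;> linarith

end LLLCertificate

/-! ## Perturbation bounds for triangular matrices -/

section Perturbation

open Matrix

attribute [local instance] Matrix.linftyOpNormedAddCommGroup Matrix.linftyOpNormedRing

variable {n : ℕ}

theorem linftyOpNorm_le_iff {M : Matrix (Fin n) (Fin n) ℝ} {r : ℝ} (hr : 0 ≤ r) :
    ‖M‖ ≤ r ↔ ∀ i, ∑ j, |M i j| ≤ r := by
  lift r to NNReal using hr
  rw [Matrix.linfty_opNorm_def]
  rw [NNReal.coe_le_coe, Finset.sup_le_iff]
  simp only [Finset.mem_univ, true_implies, ← NNReal.coe_le_coe, NNReal.coe_sum, coe_nnnorm,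
    Real.norm_eq_abs]

theorem abs_entry_le_linftyOpNorm (M : Matrix (Fin n) (Fin n) ℝ) (i j : Fin n) :
    |M i j| ≤ ‖M‖ :=
  (Finset.single_le_sum (f := fun j => |M i j|) (fun _ _ => abs_nonneg _)
    (Finset.mem_univ j)).trans ((linftyOpNorm_le_iff (norm_nonneg M)).1 le_rfl i)

theorem linftyOpNorm_mono {M N : Matrix (Fin n) (Fin n) ℝ} (h : ∀ i j, |M i j| ≤ |N i j|) :
    ‖M‖ ≤ ‖N‖ :=
  (linftyOpNorm_le_iff (norm_nonneg N)).2 fun i =>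
    (Finset.sum_le_sum fun j _ => h i j).trans ((linftyOpNorm_le_iff (norm_nonneg N)).1 le_rfl i)

/-- If `P = G + S G` with `|S| ≤ |P|` and `‖G‖ ≤ g < 1`, the second term is of second order. -/
theorem abs_mul_entry_le_of_eq_add {P S G : Matrix (Fin n) (Fin n) ℝ} {g : ℝ}
    (hP : P = G + S * G) (hS : ‖S‖ ≤ ‖P‖) (hG : ‖G‖ ≤ g) (hg : g < 1) (i j : Fin n) :
    |(S * G) i j| ≤ g ^ 2 / (1 - g) := by
  -- The norm of P is bounded in terms of itself; as g < 1, the inequality can be solved for it.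
  have h1 : ‖P‖ ≤ g + ‖P‖ * g := by
    calc ‖P‖ ≤ ‖G‖ + ‖S * G‖ := hP ▸ norm_add_le _ _
      _ ≤ ‖G‖ + ‖S‖ * ‖G‖ := by gcongr; exact norm_mul_le _ _
      _ ≤ g + ‖P‖ * g := by gcongr
  have hg0 : 0 ≤ g := (norm_nonneg G).trans hG
  have h2 : ‖P‖ ≤ g / (1 - g) := by
    rw [le_div_iff₀ (by linarith)]
    linarith
  calc |(S * G) i j| ≤ ‖S * G‖ := abs_entry_le_linftyOpNorm _ _ _
    _ ≤ ‖S‖ * ‖G‖ := norm_mul_le _ _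
    _ ≤ g / (1 - g) * g := mul_le_mul (hS.trans h2) hG (norm_nonneg G)
        ((norm_nonneg S).trans (hS.trans h2))
    _ = g ^ 2 / (1 - g) := by ring

theorem upperTriangular_inv {M : Matrix (Fin n) (Fin n) ℝ} (hM : ∀ i j, j < i → M i j = 0)
    (hdet : M.det ≠ 0) : ∀ i j, j < i → M⁻¹ i j = 0 := by
  have h : M.BlockTriangular id := fun i j hij => hM i j hij
  have := invertibleOfIsUnitDet M (isUnit_iff_ne_zero.2 hdet)
  intro i j hij
  exact blockTriangular_inv_of_blockTriangular h hij

theorem upperTriangular_mul {M N : Matrix (Fin n) (Fin n) ℝ} (hM : ∀ i j, j < i → M i j = 0)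
    (hN : ∀ i j, j < i → N i j = 0) : ∀ i j, j < i → (M * N) i j = 0 := by
  intro i j hij
  have h1 : M.BlockTriangular id := fun i j hij => hM i j hij
  have h2 : N.BlockTriangular id := fun i j hij => hN i j hij
  exact (h1.mul h2) hij

theorem upperTriangular_mul_diag {M N : Matrix (Fin n) (Fin n) ℝ}
    (hM : ∀ i j, j < i → M i j = 0) (hN : ∀ i j, j < i → N i j = 0) (i : Fin n) :
    (M * N) i i = M i i * N i i := by
  rw [mul_apply, Finset.sum_eq_single i]
  · intro k _ hk
    rcases lt_or_gt_of_ne hk with h | h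
    · rw [hM i k h, zero_mul]
    · rw [hN k i h, mul_zero]
  · simp

theorem upperTriangular_det {M : Matrix (Fin n) (Fin n) ℝ} (hM : ∀ i j, j < i → M i j = 0) :
    M.det = ∏ i, M i i :=
  det_of_isUpperTriangular fun i j hij => hM i j hij

/-- The first order approximation of the inverse of a matrix near the identity. -/
theorem inv_near_one {W : Matrix (Fin n) (Fin n) ℝ} {w : ℝ} (hw : w < 1) (hw0 : 0 ≤ w)
    (hW : ∀ i, ∑ j, |(W - 1) i j| ≤ w) :
    W.det ≠ 0 ∧ ∀ i j, |W⁻¹ i j| ≤ |(W - 2) i j| + w ^ 2 / (1 - w) := by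
  have hdet : W.det ≠ 0 := by
    -- Row sums of W - 1 below 1 make W strictly diagonally dominant.
    refine det_ne_zero_of_sum_row_lt_diag fun k => ?_
    have h1 := hW k
    rw [← Finset.add_sum_erase _ _ (Finset.mem_univ k)] at h1
    have h2 : ∑ j ∈ Finset.univ.erase k, ‖W k j‖ =
        ∑ j ∈ Finset.univ.erase k, |(W - 1) k j| := by
      refine Finset.sum_congr rfl fun j hj => ?_
      rw [Matrix.sub_apply, one_apply_ne (Finset.ne_of_mem_erase hj).symm, sub_zero,
        Real.norm_eq_abs]
    rw [h2, Real.norm_eq_abs]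
    rw [Matrix.sub_apply, one_apply_eq] at h1
    have h3 := neg_abs_le (W k k - 1)
    have h4 := le_abs_self (W k k)
    linarith
  refine ⟨hdet, fun i j => ?_⟩
  have hinv : W * W⁻¹ = 1 := mul_nonsing_inv W (isUnit_iff_ne_zero.2 hdet)
  have hinv' : W⁻¹ * W = 1 := nonsing_inv_mul W (isUnit_iff_ne_zero.2 hdet)
  have hN : ‖1 - W‖ ≤ w := by
    rw [← norm_neg, neg_sub]
    exact (linftyOpNorm_le_iff hw0).2 hW
  -- The fixed-point lemma is applied with P = S = W⁻¹(1 - W) = W⁻¹ - 1 and with 1 - W as its small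
  -- matrix.
  have h1 : W⁻¹ * (1 - W) = (1 - W) + (W⁻¹ * (1 - W)) * (1 - W) := by
    have : W⁻¹ * W * (1 - W) = 1 - W := by rw [hinv', one_mul]
    simp only [mul_sub, sub_mul, mul_one, mul_assoc] at this ⊢
    rw [← mul_assoc W⁻¹ W W, hinv', one_mul]
    abel
  have h2 := abs_mul_entry_le_of_eq_add h1 le_rfl hN hw i j
  have h3 : W⁻¹ = -(W - 2) + W⁻¹ * (1 - W) * (1 - W) := by
    simp only [mul_sub, sub_mul, mul_one, mul_assoc]
    rw [← mul_assoc W⁻¹ W W, hinv', one_mul]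
    rw [← one_add_one_eq_two]
    abel
  calc |W⁻¹ i j| = |-(W - 2) i j + (W⁻¹ * (1 - W) * (1 - W)) i j| := by
        conv_lhs => rw [h3]
        rfl
    _ ≤ |-(W - 2) i j| + |(W⁻¹ * (1 - W) * (1 - W)) i j| := abs_add_le _ _
    _ ≤ _ := by
        rw [abs_neg]
        gcongr

/-- Componentwise perturbation bound for the Cholesky factor of a matrix near the identity. -/
theorem cholesky_near_one {U G : Matrix (Fin n) (Fin n) ℝ} {g : ℝ}
    (hU : ∀ i j, j < i → U i j = 0) (hUpos : ∀ i, 0 < U i i) (hUG : Uᵀ * U = 1 + G)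
    (hg0 : 0 ≤ g) (hg : g < 1) (hG : ∀ i, ∑ j, |G i j| ≤ g) (i j : Fin n) :
    |(U - 1) i j| ≤ |G i j| + g ^ 2 / (1 - g) := by
  have hdet : U.det ≠ 0 := by
    rw [upperTriangular_det hU]
    exact Finset.prod_ne_zero_iff.2 fun i _ => (hUpos i).ne'
  set L := (U⁻¹)ᵀ with hLdef
  have hLU : L * Uᵀ = 1 := by
    rw [hLdef, ← transpose_mul, mul_nonsing_inv U (isUnit_iff_ne_zero.2 hdet), transpose_one]
  have hL : ∀ i j, i < j → L i j = 0 := fun i j hij => upperTriangular_inv hU hdet j i hij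
  have hdiag : ∀ i, L i i * U i i = 1 := by
    intro i
    have h := upperTriangular_mul_diag hU (upperTriangular_inv hU hdet) i
    rw [mul_nonsing_inv U (isUnit_iff_ne_zero.2 hdet), one_apply_eq] at h
    rw [hLdef, transpose_apply, mul_comm]
    exact h.symm
  -- U = L UᵀU = L(1 + G). Since U is upper and L lower triangular, the product LG displays their
  -- off-diagonal parts separately.
  have hULG : U = L + L * G := by
    rw [← Matrix.mul_one L, Matrix.mul_assoc, ← Matrix.mul_add, Matrix.one_mul, ← hUG,
      ← Matrix.mul_assoc, hLU, Matrix.one_mul]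
  have hdiagP : ∀ i, (L * G) i i = U i i - L i i := by
    intro i
    have := congrFun (congrFun hULG i) i
    rw [Matrix.add_apply] at this
    linarith
  have hS : ∀ i j, |(L - 1) i j| ≤ |(L * G) i j| := by
    intro i j
    rcases lt_trichotomy i j with h | rfl | h
    · rw [Matrix.sub_apply, hL i j h, one_apply_ne h.ne]
      simp
    -- On the diagonal L has 1/u where U has u. These lie on opposite sides of 1, so neither is
    -- farther from 1 than they are from each other.
    · rw [hdiagP, Matrix.sub_apply, one_apply_eq]
      have h1 := hdiag i
      have h2 := hUpos i
      have h3 : 0 < L i i := by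
        by_contra! h4
        nlinarith
      rcases le_total (U i i) 1 with h4 | h4
      · have h5 : 1 ≤ L i i := by nlinarith
        rw [abs_of_nonneg (by linarith), abs_of_nonpos (by linarith)]
        linarith
      · have h5 : L i i ≤ 1 := by nlinarith
        rw [abs_of_nonpos (by linarith), abs_of_nonneg (by linarith)]
        linarith
    · have := congrFun (congrFun hULG i) j
      rw [Matrix.add_apply, hU i j h] at this
      rw [Matrix.sub_apply, one_apply_ne h.ne', sub_zero, eq_neg_of_add_eq_zero_left this.symm,
        abs_neg]
  have hP : L * G = G + (L - 1) * G := by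
    rw [Matrix.sub_mul, Matrix.one_mul]
    abel
  have h1 := abs_mul_entry_le_of_eq_add hP (linftyOpNorm_mono hS)
    ((linftyOpNorm_le_iff hg0).2 hG) hg i j
  have h2 : |(U - 1) i j| ≤ |(L * G) i j| := by
    rcases lt_trichotomy i j with h | rfl | h
    · have := congrFun (congrFun hULG i) j
      rw [Matrix.add_apply, hL i j h, zero_add] at this
      rw [Matrix.sub_apply, one_apply_ne h.ne, sub_zero, this]
    · rw [hdiagP, Matrix.sub_apply, one_apply_eq]
      have h1 := hdiag i
      have h2 := hUpos i
      have h3 : 0 < L i i := by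
        by_contra! h4
        nlinarith
      rcases le_total (U i i) 1 with h4 | h4
      · have h5 : 1 ≤ L i i := by nlinarith
        rw [abs_of_nonpos (by linarith), abs_of_nonpos (by linarith)]
        linarith
      · have h5 : L i i ≤ 1 := by nlinarith
        rw [abs_of_nonneg (by linarith), abs_of_nonneg (by linarith)]
        linarith
    · rw [Matrix.sub_apply, hU i j h, one_apply_ne h.ne']
      simp
  refine h2.trans ?_
  rw [hP, Matrix.add_apply]
  exact (abs_add_le _ _).trans (by gcongr)

/-- Transport of a bound through a congruence. -/
theorem abs_congruence_le {Z M B T : Matrix (Fin n) (Fin n) ℝ} (hZ : ∀ i j, |Z i j| ≤ B i j)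
    (hM : ∀ i j, |M i j| ≤ T i j) (i j : Fin n) :
    |(Zᵀ * M * Z) i j| ≤ ∑ k, B k i * ∑ l, T k l * B l j := by
  rw [Matrix.mul_assoc, mul_apply]
  refine (Finset.abs_sum_le_sum_abs _ _).trans (Finset.sum_le_sum fun k _ => ?_)
  rw [abs_mul, mul_apply]
  refine mul_le_mul (hZ k i) ?_ (abs_nonneg _) ((abs_nonneg _).trans (hZ k i))
  refine (Finset.abs_sum_le_sum_abs _ _).trans (Finset.sum_le_sum fun l _ => ?_)
  rw [abs_mul]
  exact mul_le_mul (hM k l) (hZ l j) (abs_nonneg _) ((abs_nonneg _).trans (hM k l))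

/-- The backward error of an approximate triangular factor, expressed by an approximate inverse. -/
theorem gram_error_eq {A R V W : Matrix (Fin n) (Fin n) ℝ} (hW : W = R * V) (hWdet : W.det ≠ 0) :
    (R⁻¹)ᵀ * (Aᵀ * A) * R⁻¹ - 1 =
      (W⁻¹)ᵀ * (((A * V)ᵀ * (A * V) - 1) - (Wᵀ * W - 1)) * W⁻¹ := by
  have hdet : R.det ≠ 0 := by
    rw [hW, det_mul] at hWdet
    exact left_ne_zero_of_mul hWdet
  have h1 : W * W⁻¹ = 1 := mul_nonsing_inv W (isUnit_iff_ne_zero.2 hWdet)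
  have h2 : R⁻¹ * R = 1 := nonsing_inv_mul R (isUnit_iff_ne_zero.2 hdet)
  -- The inverse of R is the approximate inverse V corrected by W⁻¹, and the latter is the only
  -- exact inverse left to bound.
  have h3 : V * W⁻¹ = R⁻¹ := by
    calc V * W⁻¹ = R⁻¹ * R * V * W⁻¹ := by rw [h2, Matrix.one_mul]
      _ = R⁻¹ * (W * W⁻¹) := by rw [hW]; simp only [Matrix.mul_assoc]
      _ = R⁻¹ := by rw [h1, Matrix.mul_one]
  rw [sub_sub_sub_cancel_right, Matrix.mul_sub, Matrix.sub_mul]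
  congr 1
  · rw [← h3]
    simp only [transpose_mul, Matrix.mul_assoc]
  · calc (1 : Matrix (Fin n) (Fin n) ℝ) = (W * W⁻¹)ᵀ * (W * W⁻¹) := by rw [h1]; simp
      _ = _ := by simp only [transpose_mul, Matrix.mul_assoc]

end Perturbation

/-! ## The `QR` factor -/

section QR

open Matrix

variable {n : ℕ}

theorem IsQRFactor.transpose_mul_self {A R : Matrix (Fin n) (Fin n) ℝ} (h : IsQRFactor A R) :
    Aᵀ * A = Rᵀ * R := by
  obtain ⟨⟨Q, hQ, rfl⟩, -⟩ := h
  rw [transpose_mul, Matrix.mul_assoc, ← Matrix.mul_assoc Qᵀ, hQ, Matrix.one_mul]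

/-- The distance from an approximate triangular factor `R'` to the `QR` factor `R`. -/
theorem IsQRFactor.abs_sub_le {A R R' G H : Matrix (Fin n) (Fin n) ℝ} (hR : IsQRFactor A R)
    (hR' : ∀ i j, j < i → R' i j = 0) (hpos : ∀ i, 0 < R' i i)
    (hG : ∀ i j, |((R'⁻¹)ᵀ * (Aᵀ * A) * R'⁻¹ - 1) i j| ≤ G i j) {g : ℝ} (hg0 : 0 ≤ g)
    (hg : g < 1) (hGg : ∀ i, ∑ j, G i j ≤ g)
    (hH : ∀ i j, i ≤ j → G i j + g ^ 2 / (1 - g) ≤ H i j) (i j : Fin n) :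
    |R' i j - R i j| ≤ ∑ k with i ≤ k ∧ k ≤ j, H i k * |R' k j| := by
  have hdet : R'.det ≠ 0 := by
    rw [upperTriangular_det hR']
    exact Finset.prod_ne_zero_iff.2 fun i _ => (hpos i).ne'
  have hinv : R'⁻¹ * R' = 1 := nonsing_inv_mul R' (isUnit_iff_ne_zero.2 hdet)
  have hinv' : R' * R'⁻¹ = 1 := mul_nonsing_inv R' (isUnit_iff_ne_zero.2 hdet)
  have hZ := upperTriangular_inv hR' hdet
  -- This U is upper triangular with positive diagonal, and UᵀU is the Gram matrix of A R'⁻¹, hence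
  -- close to 1.
  set U := R * R'⁻¹ with hUdef
  have hU : ∀ i j, j < i → U i j = 0 := upperTriangular_mul hR.2.1 hZ
  have hUpos : ∀ i, 0 < U i i := by
    intro i
    rw [hUdef, upperTriangular_mul_diag hR.2.1 hZ]
    refine mul_pos (hR.2.2 i) ?_
    have h := upperTriangular_mul_diag hR' hZ i
    rw [hinv', one_apply_eq] at h
    exact (pos_iff_pos_of_mul_pos (h ▸ one_pos)).1 (hpos i)
  have hUG : Uᵀ * U = 1 + ((R'⁻¹)ᵀ * (Aᵀ * A) * R'⁻¹ - 1) := by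
    rw [hR.transpose_mul_self, hUdef, transpose_mul]
    simp only [Matrix.mul_assoc]
    abel
  have hE := cholesky_near_one hU hUpos hUG hg0 hg
    fun i => (Finset.sum_le_sum fun j _ => hG i j).trans (hGg i)
  have hUR : R - R' = (U - 1) * R' := by
    rw [Matrix.sub_mul, hUdef, Matrix.mul_assoc, hinv, Matrix.mul_one, Matrix.one_mul]
  rw [abs_sub_comm, ← Matrix.sub_apply, hUR, mul_apply]
  have hsum : ∑ k, (U - 1) i k * R' k j = ∑ k with i ≤ k ∧ k ≤ j, (U - 1) i k * R' k j := by
    symm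
    refine Finset.sum_subset (Finset.filter_subset _ _) fun k _ hk => ?_
    simp only [Finset.mem_filter, Finset.mem_univ, true_and, not_and_or, not_le] at hk
    rcases hk with hk | hk
    · rw [Matrix.sub_apply, hU i k hk, one_apply_ne hk.ne', sub_zero, zero_mul]
    · rw [hR' k j hk, mul_zero]
  rw [hsum]
  refine (Finset.abs_sum_le_sum_abs _ _).trans (Finset.sum_le_sum fun k hk => ?_)
  rw [abs_mul]
  refine mul_le_mul_of_nonneg_right ?_ (abs_nonneg _)
  refine (hE i k).trans (le_trans ?_ (hH i k (Finset.mem_filter.1 hk).2.1))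
  gcongr
  exact hG i k

end QR

/-! ### The Gram-Schmidt process as a QR factorization. -/

section GramSchmidt

open Matrix

variable {n : ℕ}

theorem linearIndependent_latticeCol {A : Matrix (Fin n) (Fin n) ℤ} (hA : A.det ≠ 0) :
    LinearIndependent ℝ (latticeCol A) := by
  have hdet : (A.map (Int.cast : ℤ → ℝ)).det ≠ 0 := by
    have h : (A.map (Int.cast : ℤ → ℝ)).det = ((A.det : ℤ) : ℝ) :=
      ((Int.castRingHom ℝ).map_det A).symm
    rw [h]
    exact_mod_cast hA
  have h := linearIndependent_cols_of_det_ne_zero hdet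
  exact h.map' (WithLp.linearEquiv 2 ℝ (Fin n → ℝ)).symm.toLinearMap
    (LinearEquiv.ker _)

/-- Q consists of the normalized Gram-Schmidt vectors b_i, and R has the entries ⟨b_i, a_j⟩. The
diagonal entry is ‖a_i*‖, because ⟨a_i*, a_i⟩ = ‖a_i*‖² by orthogonality. -/
theorem exists_isQRFactor {A : Matrix (Fin n) (Fin n) ℤ} (hA : A.det ≠ 0) :
    ∃ R : Matrix (Fin n) (Fin n) ℝ, IsQRFactor (A.map (Int.cast : ℤ → ℝ)) R := by
  have hli := linearIndependent_latticeCol hA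
  have hcard : Module.finrank ℝ (EuclideanSpace ℝ (Fin n)) = Fintype.card (Fin n) := by simp
  set b := InnerProductSpace.gramSchmidtOrthonormalBasis hcard (latticeCol A) with hb
  refine ⟨Matrix.of fun i j => b.repr (latticeCol A j) i,
    ⟨Matrix.of fun k i => b i k, ?_, ?_⟩, ?_, ?_⟩
  · ext i j
    rw [mul_apply, one_apply, ← orthonormal_iff_ite.1 b.orthonormal i j]
    simp [PiLp.inner_apply, mul_comm]
  · ext k j
    have h := congrArg (fun v : EuclideanSpace ℝ (Fin n) => v k) (b.sum_repr (latticeCol A j))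
    simp only [mul_apply, map_apply, of_apply]
    simp only [WithLp.ofLp_sum, Finset.sum_apply, PiLp.smul_apply, smul_eq_mul, latticeCol] at h
    rw [← h]
    exact Finset.sum_congr rfl fun i _ => mul_comm _ _
  · intro i j hij
    exact InnerProductSpace.gramSchmidtOrthonormalBasis_inv_triangular' hcard _ hij
  · intro i
    have hne := InnerProductSpace.gramSchmidt_ne_zero (𝕜 := ℝ) i hli
    have hbi : b i = InnerProductSpace.gramSchmidtNormed ℝ (latticeCol A) i := by
      refine InnerProductSpace.gramSchmidtOrthonormalBasis_apply hcard ?_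
      intro h0
      have := InnerProductSpace.gramSchmidtNormed_unit_length (𝕜 := ℝ) i hli
      rw [h0, norm_zero] at this
      exact zero_ne_one this
    rw [of_apply, b.repr_apply_apply, hbi, InnerProductSpace.gramSchmidtNormed]
    rw [inner_smul_left]
    have h2 : inner ℝ (InnerProductSpace.gramSchmidt ℝ (latticeCol A) i) (latticeCol A i) =
        ‖InnerProductSpace.gramSchmidt ℝ (latticeCol A) i‖ ^ 2 := by
      conv_lhs => rw [InnerProductSpace.gramSchmidt_def'' ℝ (latticeCol A) i]
      rw [inner_add_right, real_inner_self_eq_norm_sq, inner_sum, Finset.sum_eq_zero, add_zero]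
      intro j hj
      rw [inner_smul_right, InnerProductSpace.gramSchmidt_orthogonal ℝ _
        (Finset.mem_Iio.1 hj).ne', mul_zero]
    rw [h2]
    have h3 := norm_pos_iff.2 hne
    simp only [RCLike.ofReal_real_eq_id, id, conj_trivial]
    positivity

/-- The Gram-Schmidt vectors are the columns of `Q`, scaled by the diagonal of `R`. -/
theorem gsVec_eq_smul {A : Matrix (Fin n) (Fin n) ℤ} {R : Matrix (Fin n) (Fin n) ℝ}
    (hR : IsQRFactor (A.map (Int.cast : ℤ → ℝ)) R) :
    ∃ q : Fin n → EuclideanSpace ℝ (Fin n), Orthonormal ℝ q ∧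
      (∀ i j, inner ℝ (q j) (latticeCol A i) = R j i) ∧ ∀ i, gsVec A i = R i i • q i := by
  obtain ⟨⟨Q, hQ, hA⟩, hU, hpos⟩ := hR
  set q : Fin n → EuclideanSpace ℝ (Fin n) := fun i => WithLp.toLp 2 fun k => Q k i with hq
  have hon : Orthonormal ℝ q := by
    rw [orthonormal_iff_ite]
    intro i j
    have := congrFun (congrFun hQ i) j
    rw [mul_apply, one_apply] at this
    rw [← this]
    simp [hq, PiLp.inner_apply, mul_comm]
  have hcol : ∀ i, latticeCol A i = ∑ j, R j i • q j := by
    intro i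
    ext k
    have := congrFun (congrFun hA k) i
    rw [mul_apply, map_apply] at this
    simp only [latticeCol, this, WithLp.ofLp_sum, Finset.sum_apply, PiLp.smul_apply, smul_eq_mul,
      hq]
    exact Finset.sum_congr rfl fun i _ => mul_comm _ _
  have hin : ∀ i j, inner ℝ (q j) (latticeCol A i) = R j i := by
    intro i j
    rw [hcol, hon.inner_right_fintype]
  refine ⟨q, hon, hin, fun i => ?_⟩
  -- If the earlier Gram-Schmidt vectors are multiples of the q_j, the projections subtracted from
  -- a_i are exactly the terms R_ji q_j with j < i of its expansion, and R_ii q_i remains.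
  induction i using WellFoundedLT.induction with
  | ind i ih =>
    have h := InnerProductSpace.gramSchmidt_def'' ℝ (latticeCol A) i
    have hsum : ∑ j ∈ Finset.Iio i, (inner ℝ (InnerProductSpace.gramSchmidt ℝ (latticeCol A) j)
        (latticeCol A i) / ((‖InnerProductSpace.gramSchmidt ℝ (latticeCol A) j‖ : ℝ)) ^ 2) •
          InnerProductSpace.gramSchmidt ℝ (latticeCol A) j =
        ∑ j ∈ Finset.Iio i, R j i • q j := by
      refine Finset.sum_congr rfl fun j hj => ?_
      have hj' := ih j (Finset.mem_Iio.1 hj)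
      unfold gsVec at hj'
      rw [hj', inner_smul_left, hin, norm_smul, hon.1 j, smul_smul]
      congr 1
      have := (hpos j).ne'
      simp only [conj_trivial, Real.norm_eq_abs, mul_one, sq_abs]
      field_simp
    have hsplit : ∑ j, R j i • q j = R i i • q i + ∑ j ∈ Finset.Iio i, R j i • q j := by
      rw [← Finset.sum_subset (Finset.subset_univ (Finset.Iic i)),
        ← Finset.Iio_insert, Finset.sum_insert (by simp)]
      intro j _ hj
      rw [hU j i (by simpa using hj), zero_smul]
    have h' : latticeCol A i = gsVec A i + ∑ j ∈ Finset.Iio i, R j i • q j := by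
      rw [← hsum]
      exact h
    rw [hcol i, hsplit] at h'
    exact (add_right_cancel h').symm

theorem IsQRFactor.norm_gsVec {A : Matrix (Fin n) (Fin n) ℤ} {R : Matrix (Fin n) (Fin n) ℝ}
    (hR : IsQRFactor (A.map (Int.cast : ℤ → ℝ)) R) (i : Fin n) : ‖gsVec A i‖ = R i i := by
  obtain ⟨q, hon, -, h⟩ := gsVec_eq_smul hR
  rw [h, norm_smul, hon.1, mul_one, Real.norm_eq_abs, abs_of_pos (hR.2.2 i)]

theorem IsQRFactor.gsCoeff {A : Matrix (Fin n) (Fin n) ℤ} {R : Matrix (Fin n) (Fin n) ℝ}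
    (hR : IsQRFactor (A.map (Int.cast : ℤ → ℝ)) R) (i j : Fin n) :
    gsCoeff A i j = R j i / R j j := by
  unfold _root_.gsCoeff
  rw [hR.norm_gsVec]
  obtain ⟨q, -, hin, h⟩ := gsVec_eq_smul hR
  rw [h, inner_smul_right, real_inner_comm, hin]
  have := (hR.2.2 j).ne'
  field_simp

/-- Uniqueness is read off the Gram-Schmidt data, which depend on A alone: the norms determine the
diagonal, the coefficients then determine all other entries. -/
theorem existsUnique_isQRFactor {A : Matrix (Fin n) (Fin n) ℤ} (hA : A.det ≠ 0) :
    ∃! R : Matrix (Fin n) (Fin n) ℝ, IsQRFactor (A.map (Int.cast : ℤ → ℝ)) R := by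
  obtain ⟨R, hR⟩ := exists_isQRFactor hA
  refine ⟨R, hR, fun S hS => ?_⟩
  ext j i
  have hdiag : ∀ j, S j j = R j j := fun j => (hS.norm_gsVec j).symm.trans (hR.norm_gsVec j)
  have h := (hS.gsCoeff i j).symm.trans (hR.gsCoeff i j)
  rw [hdiag, div_left_inj' (hR.2.2 j).ne'] at h
  exact h

end GramSchmidt

/-! ## The computed factor and the error bound -/

namespace LLLCertificate

open Counted

variable {φ : FloatFormat} {n : ℕ}

theorem mgsStep_val_snd (st : FMat φ n × FMat φ n) (k : Fin n) :
    ∃ row : Fin n → Flt φ, (mgsStep st k).val.2 = Function.update st.2 k row ∧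
      (∀ j < k, row j = Flt.zero) ∧ ((row k).IsFinite → 0 ≤ (row k).toReal) := by
  refine ⟨_, rfl, fun j hj => ?_, fun h => ?_⟩
  · simp only [vec_val, if_neg hj.ne, if_neg hj.not_gt]
    rfl
  · simp only [vec_val, if_true] at h ⊢
    exact (Flt.sqrt_spec h).2.2

/-- Only shape and sign survive all rounding errors, overflows and NaNs, and nothing more is needed.
Row k is written in step k alone, and its diagonal entry is a square root. -/
theorem mgs_spec (A : FMat φ n) (i : Fin n) :
    (∀ j < i, (mgs A).val i j = Flt.zero) ∧
      (((mgs A).val i i).IsFinite → 0 ≤ ((mgs A).val i i).toReal) := by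
  refine foldlM_induction (fun st : FMat φ n × FMat φ n => ∀ i, (∀ j < i, st.2 i j = Flt.zero) ∧
    ((st.2 i i).IsFinite → 0 ≤ (st.2 i i).toReal)) mgsStep ?_ (List.finRange n) _ ?_ i
  · intro st k hst i
    obtain ⟨row, h1, h2, h3⟩ := mgsStep_val_snd st k
    rw [h1]
    by_cases hik : i = k
    · subst hik
      simp only [Function.update_self]
      exact ⟨h2, h3⟩
    · rw [Function.update_of_ne hik]
      exact hst i
  · exact fun i => ⟨fun _ _ => rfl, fun _ => le_rfl⟩

theorem triInv_lower (R : FMat φ n) : ∀ i j, j < i → (triInv R).val i j = Flt.zero := by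
  refine foldlM_induction (fun V : FMat φ n => ∀ i j, j < i → V i j = Flt.zero) _ ?_
    (List.finRange n).reverse _ fun _ _ _ => rfl
  intro V k hV i j hij
  rw [bind_val, pure_val]
  by_cases hik : i = k
  · subst hik
    simp only [Function.update_self, vec_val, ite_val, if_neg hij.ne', if_neg hij.not_gt]
    rfl
  · rw [Function.update_of_ne hik]
    exact hV i j hij

theorem symMat_symm (f : Fin n → Fin n → Counted (Flt φ)) (i j : Fin n) :
    (symMat f).val i j = (symMat f).val j i := by
  rw [symMat_val, symMat_val]
  rcases lt_trichotomy i j with h | rfl | h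
  · rw [if_pos h.le, if_neg h.not_ge]
  · rfl
  · rw [if_neg h.not_ge, if_pos h.le]

theorem gramBound_symm (K : Fin n → List (Fin n)) (Xlo Xhi : FMat φ n) (i j : Fin n) :
    (gramBound K Xlo Xhi).val i j = (gramBound K Xlo Xhi).val j i :=
  symMat_symm _ i j

/-- The intermediate results of the error bounding algorithm. -/
theorem errorBound_eq (Alo Ahi R' : FMat φ n) :
    ∃ (V Wlo Whi D D2 B Y Ulo Uhi X TB G H F : FMat φ n) (w g : Flt φ),
      V = (triInv R').val ∧
      Wlo = (upperMat fun i j =>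
        dot .down (idx fun k => i ≤ k ∧ k ≤ j) (R' i) (fun k => V k j)).val ∧
      Whi = (upperMat fun i j =>
        dot .up (idx fun k => i ≤ k ∧ k ≤ j) (R' i) (fun k => V k j)).val ∧
      D = (upperMat fun i j => absSubBound (Wlo i j) (Whi i j) (idEntry i j)).val ∧
      w = (normInf D).val ∧
      D2 = (upperMat fun i j => absSubBound (Wlo i j) (Whi i j) (twoIdEntry i j)).val ∧
      B = (upperMat fun i j => add .up (D2 i j) (geomTail w).val).val ∧
      Y = (gramBound (fun i => idx fun k => k ≤ i) Wlo Whi).val ∧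
      (∀ i j, Ulo i j = (dot .down (idx fun k => k ≤ j)
        (fun k => if Flt.leB Flt.zero (V k j) then Alo i k else Ahi i k) (fun k => V k j)).val) ∧
      (∀ i j, Uhi i j = (dot .up (idx fun k => k ≤ j)
        (fun k => if Flt.leB Flt.zero (V k j) then Ahi i k else Alo i k) (fun k => V k j)).val) ∧
      X = (gramBound (fun _ => List.finRange n) Ulo Uhi).val ∧
      (∀ i j, TB i j = (dot .up (idx fun k => k ≤ j)
        (fun k => Flt.add .up (X i k) (Y i k)) (fun k => B k j)).val) ∧
      G = (symMat fun i j =>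
        dot .up (idx fun k => k ≤ i) (fun k => B k i) (fun k => TB k j)).val ∧
      g = (normInf G).val ∧
      H = (upperMat fun i j => add .up (G i j) (geomTail g).val).val ∧
      F = (upperMat fun i j => dot .up (idx fun k => i ≤ k ∧ k ≤ j) (H i)
        (fun k => (R' k j).abs)).val ∧
      (errorBound Alo Ahi R').val =
        if Flt.ltB w Flt.one && Flt.ltB g Flt.one then F else fun _ _ => Flt.inf false :=
  ⟨_, _, _, _, _, _, _, _, _, _, _, _, _, _, _, _, rfl, rfl, rfl, rfl, rfl, rfl, rfl, rfl,
    fun _ _ => rfl, fun _ _ => rfl, rfl, fun _ _ => rfl, rfl, rfl, rfl, rfl, rfl⟩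

theorem sum_filter_eq_sum {P : Fin n → Prop} [DecidablePred P] {f : Fin n → ℝ}
    (h : ∀ k, ¬ P k → f k = 0) : ∑ k with P k, f k = ∑ k, f k :=
  Finset.sum_subset (Finset.filter_subset _ _) fun k _ hk => h k (by simpa using hk)

/-- The enclosure of a product with an exactly known factor. -/
theorem enclosure_mul_spec {Alo Ahi V : FMat φ n} {A : Matrix (Fin n) (Fin n) ℝ}
    (hlo : ∀ i j, (Alo i j).IsFinite → (Alo i j).toReal ≤ A i j)
    (hhi : ∀ i j, (Ahi i j).IsFinite → A i j ≤ (Ahi i j).toReal)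
    (hV : ∀ i j, j < i → V i j = Flt.zero) {i j : Fin n} {lo hi : Flt φ}
    (hlo' : lo = (dot .down (idx fun k => k ≤ j)
      (fun k => if Flt.leB Flt.zero (V k j) then Alo i k else Ahi i k) (fun k => V k j)).val)
    (hhi' : hi = (dot .up (idx fun k => k ≤ j)
      (fun k => if Flt.leB Flt.zero (V k j) then Ahi i k else Alo i k) (fun k => V k j)).val)
    (h1 : lo.IsFinite) (h2 : hi.IsFinite) :
    lo.toReal ≤ (A * Matrix.of fun i j => (V i j).toReal) i j ∧
      (A * Matrix.of fun i j => (V i j).toReal) i j ≤ hi.toReal := by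
  subst hlo' hhi'
  obtain ⟨h3, h4⟩ := dot_idx_down_spec h1
  obtain ⟨h5, h6⟩ := dot_idx_up_spec h2
  have hsum : (A * Matrix.of fun i j => (V i j).toReal) i j =
      ∑ k with k ≤ j, A i k * (V k j).toReal := by
    rw [Matrix.mul_apply, sum_filter_eq_sum]
    · rfl
    · intro k hk
      rw [hV k j (not_le.1 hk), Flt.toReal_zero, mul_zero]
  rw [hsum]
  refine ⟨h4.trans (Finset.sum_le_sum fun k hk => ?_),
    le_trans (Finset.sum_le_sum fun k hk => ?_) h6⟩
  · obtain ⟨h7, h8⟩ := h3 k (by simpa using hk)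
    -- A false comparison could also be caused by a NaN; the finiteness `h8` ensures that it means a
    -- negative entry.
    rcases hs : Flt.leB Flt.zero (V k j) with _ | _
    · simp only [hs, Bool.false_eq_true, if_false] at h7 ⊢
      have : (V k j).toReal ≤ 0 := by
        by_contra! h0
        have := (Flt.isFinite_zero.leB_iff h8).2 h0.le
        simp [hs] at this
      exact mul_le_mul_of_nonpos_right (hhi i k h7) this
    · simp only [hs, if_true] at h7 ⊢
      have := (Flt.isFinite_zero.leB_iff h8).1 hs
      exact mul_le_mul_of_nonneg_right (hlo i k h7) this
  · obtain ⟨h7, h8⟩ := h5 k (by simpa using hk)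
    rcases hs : Flt.leB Flt.zero (V k j) with _ | _
    · simp only [hs, Bool.false_eq_true, if_false] at h7 ⊢
      have : (V k j).toReal ≤ 0 := by
        by_contra! h0
        have := (Flt.isFinite_zero.leB_iff h8).2 h0.le
        simp [hs] at this
      exact mul_le_mul_of_nonpos_right (hlo i k h7) this
    · simp only [hs, if_true] at h7 ⊢
      have := (Flt.isFinite_zero.leB_iff h8).1 hs
      exact mul_le_mul_of_nonneg_right (hhi i k h7) this

open Matrix in
/-- The result of the error bounding algorithm, when finite, bounds the distance to the
`QR` factor. -/
theorem errorBound_spec {Alo Ahi R' : FMat φ n} {A R : Matrix (Fin n) (Fin n) ℝ}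
    (hlo : ∀ i j, (Alo i j).IsFinite → (Alo i j).toReal ≤ A i j)
    (hhi : ∀ i j, (Ahi i j).IsFinite → A i j ≤ (Ahi i j).toReal)
    (hR'0 : ∀ i j, j < i → R' i j = Flt.zero)
    (hR'd : ∀ i, (R' i i).IsFinite → 0 ≤ (R' i i).toReal)
    (hR : IsQRFactor A R) (hfin : ∀ i j, ((errorBound Alo Ahi R').val i j).IsFinite)
    (i j : Fin n) :
    (R' i j).IsFinite ∧ |(R' i j).toReal - R i j| ≤ ((errorBound Alo Ahi R').val i j).toReal := by
  obtain ⟨V, Wlo, Whi, D, D2, B, Y, Ulo, Uhi, X, TB, G, H, F, w, g, hV, hWlo, hWhi, hD, hw, hD2, hB,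
    hY, hUlo, hUhi, hX, hTB, hG, hg, hH, hF, hval⟩ := errorBound_eq Alo Ahi R'
  have hok : (Flt.ltB w Flt.one && Flt.ltB g Flt.one) = true := by
    by_contra h
    have := hfin i j
    rw [hval, if_neg h] at this
    exact this
  rw [hval, if_pos hok] at hfin ⊢
  rw [Bool.and_eq_true] at hok
  obtain ⟨hokW, hokG⟩ := hok
  have hV0 : ∀ i j, j < i → V i j = Flt.zero := hV ▸ triInv_lower R'
  -- finiteness, from the result back to the data
  have hF' : ∀ i j, i ≤ j → (∀ k, i ≤ k ∧ k ≤ j → (H i k).IsFinite ∧ ((R' k j).abs).IsFinite) ∧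
      ∑ k with i ≤ k ∧ k ≤ j, (H i k).toReal * ((R' k j).abs).toReal ≤ (F i j).toReal := by
    intro i j hij
    have h := hfin i j
    rw [hF, upperMat_val, if_pos hij] at h ⊢
    exact dot_idx_up_spec h
  have hH' : ∀ i j, i ≤ j → (G i j).IsFinite ∧ ((geomTail g).val).IsFinite ∧
      (G i j).toReal + ((geomTail g).val).toReal ≤ (H i j).toReal := by
    intro i j hij
    have h := ((hF' i j hij).1 j ⟨hij, le_rfl⟩).1
    rw [hH, upperMat_val, if_pos hij] at h ⊢
    exact Flt.add_up_spec h
  have hGfin : ∀ i j, (G i j).IsFinite := by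
    intro i j
    rcases le_total i j with h | h
    · exact (hH' i j h).1
    · rw [hG, symMat_symm, ← hG]
      exact (hH' j i h).1
  have hG' : ∀ i j, i ≤ j → (∀ k, k ≤ i → (B k i).IsFinite ∧ (TB k j).IsFinite) ∧
      ∑ k with k ≤ i, (B k i).toReal * (TB k j).toReal ≤ (G i j).toReal := by
    intro i j hij
    have h := hGfin i j
    rw [hG, symMat_val, if_pos hij] at h ⊢
    exact dot_idx_up_spec h
  have hB' : ∀ i j, i ≤ j → (D2 i j).IsFinite ∧ ((geomTail w).val).IsFinite ∧
      (D2 i j).toReal + ((geomTail w).val).toReal ≤ (B i j).toReal := by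
    intro i j hij
    -- Every B i j with i ≤ j is a factor in the diagonal entry G j j.
    have h := ((hG' j j le_rfl).1 i hij).1
    rw [hB, upperMat_val, if_pos hij] at h ⊢
    exact Flt.add_up_spec h
  have hB0 : ∀ i j, j < i → (B i j).toReal = 0 := by
    intro i j hij
    rw [hB, upperMat_val, if_neg hij.not_ge, Flt.toReal_zero]
  have hTB' : ∀ i j, i ≤ j → (∀ k, k ≤ j → (Flt.add .up (X i k) (Y i k)).IsFinite ∧
      (B k j).IsFinite) ∧
      ∑ k with k ≤ j, (Flt.add .up (X i k) (Y i k)).toReal * (B k j).toReal ≤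
        (TB i j).toReal := by
    intro i j hij
    have h := ((hG' i j hij).1 i le_rfl).2
    rw [hTB] at h ⊢
    exact dot_idx_up_spec h
  -- Only TB i l with i ≤ l is known to be finite, and its sum contains the entry T i j when j ≤ l;
  -- l = max i j meets both conditions.
  have hT : ∀ i j, (X i j).IsFinite ∧ (Y i j).IsFinite ∧
      (X i j).toReal + (Y i j).toReal ≤ (Flt.add .up (X i j) (Y i j)).toReal := fun i j =>
    Flt.add_up_spec ((hTB' i (Max.max i j) (le_max_left i j)).1 j (le_max_right i j)).1
  have hD2' : ∀ i j, i ≤ j → (Wlo i j).IsFinite ∧ (Whi i j).IsFinite ∧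
      ∀ x : ℝ, (Wlo i j).toReal ≤ x → x ≤ (Whi i j).toReal →
        |x - (2 : Matrix (Fin n) (Fin n) ℝ) i j| ≤ (D2 i j).toReal := by
    intro i j hij
    have h := (hB' i j hij).1
    rw [hD2, upperMat_val, if_pos hij] at h ⊢
    have := absSubBound_spec h
    rwa [toReal_twoIdEntry] at this
  -- the enclosure of `W`
  set Rr : Matrix (Fin n) (Fin n) ℝ := Matrix.of fun i j => (R' i j).toReal with hRr
  set Vr : Matrix (Fin n) (Fin n) ℝ := Matrix.of fun i j => (V i j).toReal with hVr
  obtain ⟨W, hW⟩ : ∃ W, W = Rr * Vr := ⟨_, rfl⟩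
  have hRr0 : ∀ i j, j < i → Rr i j = 0 := by
    intro i j hij
    rw [hRr, of_apply, hR'0 i j hij, Flt.toReal_zero]
  have hVr0 : ∀ i j, j < i → Vr i j = 0 := by
    intro i j hij
    rw [hVr, of_apply, hV0 i j hij, Flt.toReal_zero]
  have hW0 : ∀ i j, j < i → W i j = 0 := hW ▸ upperTriangular_mul hRr0 hVr0
  have hWsum : ∀ i j, W i j = ∑ k with i ≤ k ∧ k ≤ j, (R' i k).toReal * (V k j).toReal := by
    intro i j
    rw [hW, mul_apply, sum_filter_eq_sum]
    · rfl
    · intro k hk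
      rw [not_and_or, not_le, not_le] at hk
      rcases hk with hk | hk
      · rw [hR'0 i k hk, Flt.toReal_zero, zero_mul]
      · rw [hV0 k j hk, Flt.toReal_zero, mul_zero]
  have hWenc : ∀ i j, (Wlo i j).toReal ≤ W i j ∧ W i j ≤ (Whi i j).toReal := by
    intro i j
    rcases lt_or_ge j i with hij | hij
    · rw [hWlo, hWhi, upperMat_val, upperMat_val, if_neg hij.not_ge, if_neg hij.not_ge, hW0 i j hij]
      exact ⟨le_rfl, le_rfl⟩
    · obtain ⟨h1, h2, -⟩ := hD2' i j hij
      rw [hWlo, upperMat_val, if_pos hij] at h1 ⊢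
      rw [hWhi, upperMat_val, if_pos hij] at h2 ⊢
      rw [hWsum]
      exact ⟨(dot_idx_down_spec h1).2, (dot_idx_up_spec h2).2⟩
  have hR'fin : ∀ i j, (R' i j).IsFinite := by
    intro i j
    rcases lt_or_ge j i with hij | hij
    · rw [hR'0 i j hij]
      exact Flt.isFinite_zero
    · have h := (hD2' i j hij).1
      rw [hWlo, upperMat_val, if_pos hij] at h
      exact ((dot_idx_down_spec h).1 j ⟨hij, le_rfl⟩).1
  refine ⟨hR'fin i j, ?_⟩
  -- invertibility of `W`
  have hDne : ∀ i j, D i j ≠ Flt.inf true := by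
    intro i j
    rw [hD, upperMat_val]
    split_ifs
    · exact absSubBound_ne _ _ _
    · simp [Flt.zero]
  rw [hw] at hokW
  obtain ⟨hwfin, hw0, hw1, hwsum⟩ := normInf_spec hDne hokW
  rw [← hw] at hwfin hw0 hw1 hwsum
  have hWD : ∀ i j, |(W - 1) i j| ≤ (D i j).toReal := by
    intro i j
    have h := (hwsum i).1 j
    rw [Matrix.sub_apply]
    rw [hD, upperMat_val] at h ⊢
    rcases lt_or_ge j i with hij | hij
    · rw [if_neg hij.not_ge, hW0 i j hij, one_apply_ne hij.ne']
      simp [Flt.toReal_zero]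
    · rw [if_pos hij] at h ⊢
      have := (absSubBound_spec h).2.2 _ (hWenc i j).1 (hWenc i j).2
      rwa [toReal_idEntry] at this
  obtain ⟨hWdet, hWinv⟩ := inv_near_one hw1 hw0 fun i =>
    (Finset.sum_le_sum fun j _ => hWD i j).trans (hwsum i).2
  have hZB : ∀ i j, |W⁻¹ i j| ≤ (B i j).toReal := by
    intro i j
    rcases lt_or_ge j i with hij | hij
    · rw [upperTriangular_inv hW0 hWdet i j hij, hB0 i j hij, abs_zero]
    · obtain ⟨-, h1, h2⟩ := hB' i j hij
      have h3 := (hD2' i j hij).2.2 _ (hWenc i j).1 (hWenc i j).2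
      have h4 := geomTail_spec hwfin hw1 h1
      have h5 := hWinv i j
      rw [Matrix.sub_apply] at h5
      linarith
  -- the two Gram matrices
  have hYb : ∀ i j, i ≤ j → |(Wᵀ * W - 1) i j| ≤ (Y i j).toReal := by
    intro i j hij
    have h := (hT i j).2.1
    rw [hY] at h ⊢
    have h1 := gramBound_spec (fun i => nodup_idx _) (fun i j _ _ => hWenc i j) hij h
    rw [toFinset_idx, sum_filter_eq_sum] at h1
    · rwa [Matrix.sub_apply, mul_apply]
    · intro k hk
      rw [hW0 k i (not_le.1 hk), zero_mul]
  have hXb : ∀ i j, i ≤ j → |((A * Vr)ᵀ * (A * Vr) - 1) i j| ≤ (X i j).toReal := by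
    intro i j hij
    have h := (hT i j).1
    rw [hX] at h ⊢
    have h1 := gramBound_spec (X := A * Vr) (fun _ => List.nodup_finRange n)
      (fun i j h1 h2 => enclosure_mul_spec hlo hhi hV0 (hUlo i j) (hUhi i j) h1 h2) hij h
    rw [List.toFinset_finRange] at h1
    rwa [Matrix.sub_apply, mul_apply]
  have hMT : ∀ i j, |(((A * Vr)ᵀ * (A * Vr) - 1) - (Wᵀ * W - 1)) i j| ≤
      (Flt.add .up (X i j) (Y i j)).toReal := by
    have key : ∀ i j, i ≤ j → |(((A * Vr)ᵀ * (A * Vr) - 1) - (Wᵀ * W - 1)) i j| ≤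
        (Flt.add .up (X i j) (Y i j)).toReal := by
      intro i j hij
      rw [Matrix.sub_apply]
      exact (abs_sub _ _).trans ((add_le_add (hXb i j hij) (hYb i j hij)).trans (hT i j).2.2)
    intro i j
    rcases le_total i j with hij | hij
    · exact key i j hij
    · have hsymm : ((((A * Vr)ᵀ * (A * Vr) - 1) - (Wᵀ * W - 1)))ᵀ =
          ((A * Vr)ᵀ * (A * Vr) - 1) - (Wᵀ * W - 1) := by
        simp only [transpose_sub, transpose_mul, transpose_transpose, transpose_one]
      rw [← hsymm, transpose_apply, hX, hY, gramBound_symm _ _ _ i j, gramBound_symm _ _ _ i j,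
        ← hX, ← hY]
      exact key j i hij
  -- the bound `G`
  have hGb : ∀ i j, |((Rr⁻¹)ᵀ * (Aᵀ * A) * Rr⁻¹ - 1) i j| ≤ (G i j).toReal := by
    have key : ∀ i j, i ≤ j → |((Rr⁻¹)ᵀ * (Aᵀ * A) * Rr⁻¹ - 1) i j| ≤ (G i j).toReal := by
      intro i j hij
      rw [gram_error_eq hW hWdet]
      refine (abs_congruence_le (B := Matrix.of fun i j => (B i j).toReal)
        (T := Matrix.of fun i j => (Flt.add .up (X i j) (Y i j)).toReal) hZB hMT i j).trans ?_
      refine le_trans ?_ (hG' i j hij).2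
      simp only [of_apply]
      -- The algorithm sums over structurally nonzero terms only; B is upper triangular, so the full
      -- sums agree with the truncated ones.
      rw [← sum_filter_eq_sum (P := fun k => k ≤ i)]
      · refine Finset.sum_le_sum fun k hk => ?_
        refine mul_le_mul_of_nonneg_left ?_ ((abs_nonneg _).trans (hZB k i))
        rw [← sum_filter_eq_sum (P := fun l => l ≤ j)]
        · exact (hTB' k j (le_trans (by simpa using hk) hij)).2
        · intro l hl
          rw [hB0 l j (not_le.1 hl), mul_zero]
      · intro k hk
        rw [hB0 k i (not_le.1 hk), zero_mul]
    intro i j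
    rcases le_total i j with hij | hij
    · exact key i j hij
    · have hsymm : ((Rr⁻¹)ᵀ * (Aᵀ * A) * Rr⁻¹ - 1)ᵀ = (Rr⁻¹)ᵀ * (Aᵀ * A) * Rr⁻¹ - 1 := by
        simp only [transpose_sub, transpose_mul, transpose_transpose, transpose_one,
          Matrix.mul_assoc]
      rw [← hsymm, transpose_apply, hG, symMat_symm, ← hG]
      exact key j i hij
  have hGne : ∀ i j, G i j ≠ Flt.inf true := by
    intro i j h
    have := hGfin i j
    rw [h] at this
    exact this
  rw [hg] at hokG
  obtain ⟨hgfin, hg0, hg1, hgsum⟩ := normInf_spec hGne hokG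
  rw [← hg] at hgfin hg0 hg1 hgsum
  -- positivity of the diagonal
  have hpos : ∀ i, 0 < Rr i i := by
    intro i
    -- det W = det R' · det V is nonzero, so no diagonal entry of the triangular R' vanishes.
    refine lt_of_le_of_ne (hR'd i (hR'fin i i)) (Ne.symm ?_)
    rw [hW, det_mul, upperTriangular_det hRr0] at hWdet
    exact Finset.prod_ne_zero_iff.1 (left_ne_zero_of_mul hWdet) i (Finset.mem_univ i)
  rcases lt_or_ge j i with hij | hij
  · rw [hR'0 i j hij, hR.2.1 i j hij, hF, upperMat_val, if_neg hij.not_ge, Flt.toReal_zero]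
    simp
  · refine (hR.abs_sub_le hRr0 hpos (G := Matrix.of fun i j => (G i j).toReal)
      (H := Matrix.of fun i j => (H i j).toReal) hGb hg0 hg1 (fun i => (hgsum i).2) ?_ i j).trans ?_
    · intro i j hij
      obtain ⟨-, h1, h2⟩ := hH' i j hij
      have := geomTail_spec hgfin hg1 h1
      simp only [of_apply]
      linarith
    · have h := (hF' i j hij).2
      simp only [Flt.toReal_abs] at h
      exact h

end LLLCertificate

/-! ## The tests -/

namespace Flt

variable {φ : FloatFormat}

/-- Serves to reject infinite factors in the tests: the product is NaN, or an infinity of known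
sign, and either makes the comparison fail there. -/
theorem mul_inf_left (m : Rounding) (t : Bool) {b : Flt φ} (hb : b.IsFinite)
    (h0 : 0 ≤ b.toReal) : mul m (inf t) b = nan ∨ mul m (inf t) b = inf t := by
  match b, hb with
  | fin false y _, _ =>
    simp only [mul]
    split_ifs
    · exact .inl rfl
    · exact .inr (by simp)
  | fin true y hy, _ =>
    have : y = 0 := by
      rw [toReal_fin_true] at h0
      linarith [hy.nonneg]
    exact .inl (if_pos this)

theorem mul_inf_right (m : Rounding) (t : Bool) {a : Flt φ} (ha : a.IsFinite)
    (h0 : 0 ≤ a.toReal) : mul m a (inf t) = nan ∨ mul m a (inf t) = inf t := by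
  match a, ha with
  | fin false x _, _ =>
    simp only [mul]
    split_ifs
    · exact .inl rfl
    · exact .inr (by simp)
  | fin true x hx, _ =>
    have : x = 0 := by
      rw [toReal_fin_true] at h0
      linarith [hx.nonneg]
    exact .inl (if_pos this)

theorem sqrt_up_ne (a : Flt φ) : sqrt .up a ≠ inf true := by
  match a with
  | nan => simp [sqrt]
  | inf true => simp [sqrt]
  | inf false => simp [sqrt]
  | fin s x hx =>
    simp only [sqrt]
    split_ifs
    · simp
    · simp
    · exact round_up_ne _ _

theorem add_up_cases {a b : Flt φ} (ha : a.IsFinite) (hb : b.IsFinite) :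
    add .up a b = inf false ∨
      (add .up a b).IsFinite ∧ a.toReal + b.toReal ≤ (add .up a b).toReal := by
  obtain ⟨z, hz⟩ := add_of_isFinite .up ha hb
  rw [hz]
  rcases round_up_spec (φ := φ) z (a.toReal + b.toReal) with h | h
  · exact .inl h.1
  · exact .inr ⟨h.1, h.2.1⟩

theorem sub_down_cases {a b : Flt φ} (ha : a.IsFinite) (hb : b.IsFinite) :
    sub .down a b = inf true ∨
      (sub .down a b).IsFinite ∧ (sub .down a b).toReal ≤ a.toReal - b.toReal := by
  obtain ⟨z, hz⟩ := sub_of_isFinite .down ha hb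
  rw [hz]
  rcases round_down_spec (φ := φ) z (a.toReal - b.toReal) with h | h
  · exact .inl h.1
  · exact .inr ⟨h.1, h.2.1⟩

/-- The product of the test of the Lovász condition. -/
theorem mul_up_sqrt_spec {t a b : Flt φ} (ha : a = inf false ∨ a.IsFinite ∧ 0 ≤ a.toReal)
    (hb : b = inf true ∨ b.IsFinite) (h : leB (mul .up (sqrt .up t) a) b = true) :
    a.IsFinite ∧ b.IsFinite ∧ t.IsFinite ∧ 0 ≤ t.toReal ∧
      Real.sqrt t.toReal * a.toReal ≤ b.toReal := by
  obtain ⟨h1, -, h3⟩ := leB_eq_true.1 h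
  -- The right-hand side is not +∞, so a product equal to +∞ would have failed the test.
  have hne : mul .up (sqrt .up t) a ≠ inf false := by
    intro h4
    rw [h4] at h3
    rcases hb with rfl | hb
    · exact absurd h3 (not_le.2 bot_lt_top)
    · rw [hb.toEReal_eq] at h3
      exact absurd h3 (not_le.2 (EReal.coe_lt_top _))
  have hnan : mul .up (sqrt .up t) a ≠ nan := by
    intro h4
    rw [h4] at h1
    exact h1 trivial
  have hs : (sqrt .up t).IsFinite := by
    refine isFinite_of_ne ?_ (sqrt_up_ne t) fun hs => ?_
    · intro hs
      match h4 : sqrt .up t, hs with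
      | nan, _ =>
        rw [h4] at hnan
        exact hnan rfl
    · rw [hs] at hne hnan
      rcases ha with rfl | ⟨ha, ha0⟩
      · exact hne rfl
      · rcases mul_inf_left .up false ha ha0 with h4 | h4
        · exact hnan h4
        · exact hne h4
  obtain ⟨ht, ht0, hs0⟩ := sqrt_spec hs
  have hs1 := sqrt_up_spec hs
  have ha' : a.IsFinite ∧ 0 ≤ a.toReal := by
    rcases ha with rfl | ha
    · rcases mul_inf_right .up false hs hs0 with h4 | h4
      · exact absurd h4 hnan
      · exact absurd h4 hne
    · exact ha
  obtain ⟨z, hz⟩ := mul_of_isFinite .up hs ha'.1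
  have hm : (mul .up (sqrt .up t) a).IsFinite :=
    isFinite_of_ne h1 (hz ▸ round_up_ne _ _) hne
  have hb' : b.IsFinite := by
    rcases hb with rfl | hb
    · rw [hm.toEReal_eq] at h3
      exact absurd h3 (not_le.2 (EReal.bot_lt_coe _))
    · exact hb
  rw [hm.toEReal_eq, hb'.toEReal_eq, EReal.coe_le_coe_iff] at h3
  refine ⟨ha'.1, hb', ht, ht0, le_trans ?_ ((mul_up_spec hm).2.2.trans h3)⟩
  exact mul_le_mul_of_nonneg_right hs1 ha'.2

end Flt

/-! ### Soundness of the tests and of the certificate. -/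

namespace LLLCertificate

open Counted

variable {φ : FloatFormat} {n : ℕ}

theorem finiteTest_spec {F : FMat φ n} (h : (finiteTest F).val = true) (i j : Fin n) :
    (F i j).IsFinite := by
  have h1 : Flt.ltB (F i j).abs (Flt.inf false) = true := of_decide_eq_true h i j
  obtain ⟨h2, -, h3⟩ := Flt.ltB_eq_true.1 h1
  rw [← Flt.isFinite_abs]
  refine Flt.isFinite_of_ne h2 (Flt.abs_ne _) fun h4 => ?_
  rw [h4] at h3
  exact lt_irrefl _ h3

/-- |R_ij| is at most the tested left side, and R_ii is at least the rounded difference. As the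
rounded η is nonnegative, the product bounds η R_ii from below. -/
theorem properTest_spec {R' F : FMat φ n} {R : Matrix (Fin n) (Fin n) ℝ} {η : ℝ} (hη : 0 ≤ η)
    (hR' : ∀ i j, (R' i j).IsFinite) (hF : ∀ i j, (F i j).IsFinite) (hR : ∀ i, 0 < R i i)
    (hb : ∀ i j, |(R' i j).toReal - R i j| ≤ (F i j).toReal)
    (h : (properTest R' F η).val = true) {i j : Fin n} (hij : i < j) :
    |R i j| ≤ η * R i i := by
  have h1 : Flt.leB (Flt.add .up (R' i j).abs (F i j))
      (Flt.mul .down (Flt.sub .down (R' i i) (F i i)) (Flt.ofReal .down η)) = true := by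
    have := of_decide_eq_true h i j
    simp only [mat_val, if_pos hij] at this
    exact this
  obtain ⟨-, h2, h3⟩ := Flt.leB_eq_true.1 h1
  obtain ⟨hηf, hη1, hη0⟩ : (Flt.ofReal .down η : Flt φ).IsFinite ∧
      (Flt.ofReal .down η : Flt φ).toReal ≤ η ∧ 0 ≤ (Flt.ofReal .down η : Flt φ).toReal := by
    rcases Flt.round_down_spec (φ := φ) false η with ⟨h4, h5⟩ | ⟨h4, h5, h6⟩
    -- The general specification leaves -∞ open at 0, but zero is rounded exactly.
    · have : η = 0 := le_antisymm h5 hη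
      subst this
      have h7 := Flt.round_of_isMagnitude (φ := φ) .down false (x := 0)
        (by simpa using φ.isMagnitude_zero)
      rw [h4] at h7
      exact h7.1.elim
    · exact ⟨h4, h5, h6 hη⟩
  have hbot : (⊥ : EReal) < (Flt.add .up (R' i j).abs (F i j)).toEReal := by
    rcases Flt.add_up_cases (Flt.isFinite_abs.2 (hR' i j)) (hF i j) with h4 | ⟨h4, -⟩
    · rw [h4]
      exact bot_lt_top
    · rw [h4.toEReal_eq]
      exact EReal.bot_lt_coe _
  rcases Flt.sub_down_cases (hR' i i) (hF i i) with h4 | ⟨h4, h5⟩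
  · rw [h4] at h2 h3
    rcases Flt.mul_inf_left .down true hηf hη0 with h6 | h6
    · rw [h6] at h2
      exact absurd trivial h2
    · rw [h6] at h3
      exact absurd (hbot.trans_le h3) (lt_irrefl _)
  · obtain ⟨z, hz⟩ := Flt.mul_of_isFinite .down h4 hηf
    have hm : (Flt.mul .down (Flt.sub .down (R' i i) (F i i)) (Flt.ofReal .down η)).IsFinite := by
      refine Flt.isFinite_of_ne h2 (fun h6 => ?_) (hz ▸ Flt.round_down_ne _ _)
      rw [h6] at h3
      exact absurd (hbot.trans_le h3) (lt_irrefl _)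
    obtain ⟨h6, h7⟩ := Flt.isFinite_of_toEReal_le (Flt.leB_eq_true.1 h1).1
      (fun h8 => by rw [h8] at hbot; exact lt_irrefl _ hbot) hm h3
    have h8 := (Flt.add_up_spec h6).2.2
    have h9 := (Flt.mul_down_spec hm).2.2
    rw [Flt.toReal_abs] at h8
    have h10 := abs_le.1 (hb i i)
    have h11 : |R i j| ≤ |(R' i j).toReal| + (F i j).toReal := by
      have h12 := abs_sub_abs_le_abs_sub (R i j) (R' i j).toReal
      rw [abs_sub_comm] at h12
      linarith [hb i j]
    calc |R i j| ≤ (Flt.sub .down (R' i i) (F i i)).toReal * (Flt.ofReal .down η).toReal := by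
          linarith
      _ ≤ R i i * (Flt.ofReal .down η).toReal :=
          mul_le_mul_of_nonneg_right (by linarith) hη0
      _ ≤ R i i * η := mul_le_mul_of_nonneg_left hη1 (hR i).le
      _ = η * R i i := mul_comm _ _

/-- With T ≥ R_ii the computed `ti`, q satisfies 0 ≤ qT ≤ |R_ii'|. Squaring the tested inequality
gives δT² - (qT)² ≤ R_i'i'², and both terms on the left can be replaced separately by δR_ii² and
R_ii'². No sign of δ - q² is needed, only δ ≥ 0. -/
theorem lovaszTest_spec {R' F : FMat φ n} {R : Matrix (Fin n) (Fin n) ℝ} {δ : ℝ} (hδ : 0 ≤ δ)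
    (hR' : ∀ i j, (R' i j).IsFinite) (hF : ∀ i j, (F i j).IsFinite) (hR : ∀ i, 0 < R i i)
    (hb : ∀ i j, |(R' i j).toReal - R i j| ≤ (F i j).toReal)
    (h : (lovaszTest R' F δ).val = true) {i i' : Fin n} (hi' : (i' : ℕ) = (i : ℕ) + 1) :
    δ * R i i ^ 2 - R i i' ^ 2 ≤ R i' i' ^ 2 := by
  have hlt : (i : ℕ) + 1 < n := hi' ▸ i'.isLt
  obtain rfl : i' = ⟨i + 1, hlt⟩ := Fin.ext hi'
  set i' : Fin n := ⟨i + 1, hlt⟩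
  set ti := Flt.add .up (R' i i) (F i i) with hti
  set tn := Flt.sub .down (R' i' i') (F i' i') with htn
  set a := Flt.max (Flt.sub .down (R' i i').abs (F i i')) Flt.zero with ha
  set q := Flt.div .down a ti with hq
  have h1 : Flt.leB (Flt.mul .up (Flt.sqrt .up
      (Flt.sub .down (Flt.mul .down q q) (Flt.ofReal .up δ)).neg) ti) tn = true := by
    have := of_decide_eq_true h i
    simp only [vec_val, dif_pos hlt] at this
    exact this
  have hii := abs_le.1 (hb i i)
  have hii' := abs_le.1 (hb i' i')
  have hti' : ti = Flt.inf false ∨ ti.IsFinite ∧ R i i ≤ ti.toReal := by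
    rcases Flt.add_up_cases (hR' i i) (hF i i) with h2 | ⟨h2, h3⟩
    · exact .inl h2
    · exact .inr ⟨h2, by linarith⟩
  have htn' : tn = Flt.inf true ∨ tn.IsFinite ∧ tn.toReal ≤ R i' i' := by
    rcases Flt.sub_down_cases (hR' i' i') (hF i' i') with h2 | ⟨h2, h3⟩
    · exact .inl h2
    · exact .inr ⟨h2, by linarith⟩
  obtain ⟨htif, htnf, htf, ht0, hle⟩ := Flt.mul_up_sqrt_spec
    (hti'.imp_right fun h => ⟨h.1, (hR i).le.trans h.2⟩) (htn'.imp_right fun h => h.1) h1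
  have hti1 : R i i ≤ ti.toReal := by
    rcases hti' with h2 | h2
    · rw [h2] at htif
      exact htif.elim
    · exact h2.2
  have htn1 : tn.toReal ≤ R i' i' := by
    rcases htn' with h2 | h2
    · rw [h2] at htnf
      exact htnf.elim
    · exact h2.2
  have htipos : 0 < ti.toReal := (hR i).trans_le hti1
  obtain ⟨hqq, hδf, hδ1⟩ := Flt.sub_down_spec (Flt.isFinite_neg.1 htf)
  obtain ⟨hqf, -, hqq1⟩ := Flt.mul_down_spec hqq
  have hδ2 := Flt.ofReal_up_spec hδf
  have haf : a.IsFinite := Flt.isFinite_left_of_div hqf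
  obtain ⟨ha1, -, -, ha2, ha3⟩ := Flt.max_spec (a := Flt.sub .down (R' i i').abs (F i i'))
    (b := Flt.zero) haf.not_isNaN
  have ha0 : 0 ≤ a.toReal := by
    rw [← ha, haf.toEReal_eq, Flt.isFinite_zero.toEReal_eq, EReal.coe_le_coe_iff] at ha2
    exact ha2
  have haR : a.toReal ≤ |R i i'| := by
    rcases ha3 with h2 | h2
    · rw [← ha] at h2
      rw [h2] at haf ⊢
      have h3 := (Flt.sub_down_spec haf).2.2
      rw [Flt.toReal_abs] at h3
      have h4 := abs_sub_abs_le_abs_sub (R' i i').toReal (R i i')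
      linarith [hb i i']
    · rw [← ha] at h2
      rw [h2]
      exact abs_nonneg _
  obtain ⟨z, hz⟩ := Flt.div_of_isFinite .down haf htif htipos.ne'
  rw [← hq] at hz
  -- The maximum with 0 makes q nonnegative, so that the upper bound on q can be squared.
  have hq0 : 0 ≤ q.toReal ∧ q.toReal ≤ a.toReal / ti.toReal := by
    rcases Flt.round_down_spec (φ := φ) z (a.toReal / ti.toReal) with ⟨h2, -⟩ | ⟨-, h3, h4⟩
    · rw [hz, h2] at hqf
      exact hqf.elim
    · rw [hz]
      exact ⟨h4 (by positivity), h3⟩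
  rw [Flt.toReal_neg] at ht0 hle
  set t := -(Flt.sub .down (Flt.mul .down q q) (Flt.ofReal .up δ)).toReal with ht
  have hq1 : q.toReal * ti.toReal ≤ |R i i'| := by
    have := (le_div_iff₀ htipos).1 hq0.2
    linarith
  have hq2 : (q.toReal * ti.toReal) ^ 2 ≤ R i i' ^ 2 := by
    rw [← sq_abs (R i i')]
    exact pow_le_pow_left₀ (mul_nonneg hq0.1 htipos.le) hq1 2
  have ht1 : δ - q.toReal ^ 2 ≤ t := by
    rw [sq, ht]
    linarith
  have h2 : (Real.sqrt t * ti.toReal) ^ 2 ≤ R i' i' ^ 2 :=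
    pow_le_pow_left₀ (by positivity) (hle.trans htn1) 2
  rw [mul_pow, Real.sq_sqrt ht0] at h2
  rw [mul_pow] at hq2
  have h3 : (δ - q.toReal ^ 2) * ti.toReal ^ 2 ≤ t * ti.toReal ^ 2 :=
    mul_le_mul_of_nonneg_right ht1 (sq_nonneg _)
  have h4 : δ * R i i ^ 2 ≤ δ * ti.toReal ^ 2 :=
    mul_le_mul_of_nonneg_left (pow_le_pow_left₀ (hR i).le hti1 2) hδ
  linarith

/-- The values of a run of the certificate. -/
theorem certificate_val (A : Matrix (Fin n) (Fin n) ℤ) (δ η : ℝ) :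
    (certificate φ A δ η).val =
      let R' := (mgs fun i j => (Flt.ofReal .nearest (A i j : ℝ) : Flt φ)).val
      let F := (errorBound (fun i j => Flt.ofReal .down (A i j : ℝ))
        (fun i j => Flt.ofReal .up (A i j : ℝ)) R').val
      ⟨R', F, if (finiteTest F).val && (properTest R' F η).val && (lovaszTest R' F δ).val
        then .reduced else .failed⟩ := rfl

theorem certificate_error_bound {A : Matrix (Fin n) (Fin n) ℤ} {R : Matrix (Fin n) (Fin n) ℝ}
    (hR : IsQRFactor (A.map (Int.cast : ℤ → ℝ)) R) {δ η : ℝ}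
    (hF : ∀ i j, ((certificate φ A δ η).val.F i j).IsFinite) (i j : Fin n) :
    ((certificate φ A δ η).val.Rapprox i j).IsFinite ∧
      |((certificate φ A δ η).val.Rapprox i j).toReal - R i j| ≤
        ((certificate φ A δ η).val.F i j).toReal := by
  rw [certificate_val] at hF ⊢
  simp only at hF ⊢
  have hlo : ∀ i j, (Flt.ofReal .down (A i j : ℝ) : Flt φ).IsFinite →
      (Flt.ofReal .down (A i j : ℝ) : Flt φ).toReal ≤ A.map (Int.cast : ℤ → ℝ) i j :=
    fun i j h => by
      rw [Matrix.map_apply]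
      exact Flt.ofReal_down_spec h
  have hhi : ∀ i j, (Flt.ofReal .up (A i j : ℝ) : Flt φ).IsFinite →
      A.map (Int.cast : ℤ → ℝ) i j ≤ (Flt.ofReal .up (A i j : ℝ) : Flt φ).toReal :=
    fun i j h => by
      rw [Matrix.map_apply]
      exact Flt.ofReal_up_spec h
  have hmgs := mgs_spec fun i j => (Flt.ofReal .nearest (A i j : ℝ) : Flt φ)
  exact errorBound_spec hlo hhi (fun i j hij => (hmgs i).1 j hij) (fun i => (hmgs i).2) hR hF i j

/-- The soundness of the certificate. -/
theorem certificate_sound {A : Matrix (Fin n) (Fin n) ℤ} (hA : A.det ≠ 0) {δ η : ℝ} (hδ : 0 ≤ δ)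
    (hη : 0 ≤ η) :
    (certificate φ A δ η).val.answer = .failed ∨
      (certificate φ A δ η).val.answer = .reduced ∧ IsLLLReduced A δ η := by
  obtain ⟨R, hR, -⟩ := existsUnique_isQRFactor hA
  have hbound := certificate_error_bound (φ := φ) hR (δ := δ) (η := η)
  rw [certificate_val] at hbound ⊢
  simp only at hbound ⊢
  set R' := (mgs fun i j => (Flt.ofReal .nearest (A i j : ℝ) : Flt φ)).val
  set F := (errorBound (fun i j => Flt.ofReal .down (A i j : ℝ))
    (fun i j => Flt.ofReal .up (A i j : ℝ)) R').val
  split_ifs with h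
  · right
    simp only [Bool.and_eq_true] at h
    obtain ⟨⟨h1, h2⟩, h3⟩ := h
    have hF := finiteTest_spec h1
    have hb := hbound hF
    refine ⟨rfl, linearIndependent_latticeCol hA, fun i j hij => ?_, fun i i' hi => ?_⟩
    · rw [hR.gsCoeff, abs_div, abs_of_pos (hR.2.2 j), div_le_iff₀ (hR.2.2 j)]
      exact properTest_spec hη (fun i j => (hb i j).1) hF hR.2.2 (fun i j => (hb i j).2) h2 hij
    · have h4 := lovaszTest_spec hδ (fun i j => (hb i j).1) hF hR.2.2 (fun i j => (hb i j).2) h3 hi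
      rw [hR.gsCoeff, hR.norm_gsVec, hR.norm_gsVec]
      have h5 := (hR.2.2 i).ne'
      have h6 : (δ - (R i i' / R i i) ^ 2) * R i i ^ 2 = δ * R i i ^ 2 - R i i' ^ 2 := by
        field_simp
      rwa [h6]
  · exact .inl rfl

end LLLCertificate

/-! ## The number of operations -/

section IndexCount

theorem sum_sum_ite_le (n : ℕ) (f : ℕ → ℕ → ℕ) :
    ∑ i : Fin n, ∑ j : Fin n, (if i ≤ j then f i j else 0) =
      ∑ j ∈ Finset.range n, ∑ i ∈ Finset.range (j + 1), f i j := by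
  rw [Finset.sum_comm, Finset.sum_range]
  refine Finset.sum_congr rfl fun j _ => ?_
  rw [← Finset.sum_filter]
  have h := Finset.sum_map (Finset.univ.filter fun i : Fin n => i ≤ j) Fin.valEmbedding
    fun i => f i j
  simp only [Fin.valEmbedding_apply] at h
  rw [← h]
  congr 1
  ext k
  simp only [Finset.mem_map, Finset.mem_filter, Finset.mem_univ, true_and, Fin.valEmbedding_apply,
    Finset.mem_range, Nat.lt_succ_iff]
  constructor
  · rintro ⟨i, hi, rfl⟩
    exact hi
  · intro hk
    exact ⟨⟨k, hk.trans_lt j.isLt⟩, hk, rfl⟩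

theorem two_mul_sum_range_succ (n : ℕ) :
    2 * ∑ j ∈ Finset.range n, (j + 1) = n * (n + 1) := by
  induction n with
  | zero => rfl
  | succ n ih =>
    rw [Finset.sum_range_succ, mul_add, ih]
    ring

theorem six_mul_sum_sum_range_succ (n : ℕ) :
    6 * ∑ j ∈ Finset.range n, ∑ i ∈ Finset.range (j + 1), (i + 1) = n * (n + 1) * (n + 2) := by
  induction n with
  | zero => rfl
  | succ n ih =>
    rw [Finset.sum_range_succ, mul_add, ih]
    have := two_mul_sum_range_succ (n + 1)
    linear_combination 3 * this

theorem two_mul_card_le (n : ℕ) :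
    2 * ∑ i : Fin n, ∑ j : Fin n, (if i ≤ j then 1 else 0) = n * (n + 1) := by
  rw [sum_sum_ite_le n fun _ _ => 1, ← two_mul_sum_range_succ]
  simp

theorem card_lt_add (n : ℕ) :
    ∑ i : Fin n, ∑ j : Fin n, (if i < j then 1 else 0) + n =
      ∑ i : Fin n, ∑ j : Fin n, (if i ≤ j then 1 else 0) := by
  have h : ∀ i j : Fin n, (if i ≤ j then 1 else 0) =
      (if i < j then 1 else 0) + if i = j then 1 else 0 := by
    intro i j
    rcases lt_trichotomy i j with h | rfl | h
    · simp [h, h.le, h.ne]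
    · simp
    · simp [h.not_gt, h.not_ge, h.ne']
  simp only [h, Finset.sum_add_distrib]
  simp

/-- For fixed j the reflection i ↦ j - i turns the interval lengths into 1, ..., j + 1, and
tetrahedral numbers appear. -/
theorem six_mul_sum_card_interval (n : ℕ) :
    6 * ∑ i : Fin n, ∑ j : Fin n, (if i ≤ j then (j : ℕ) + 1 - i else 0) =
      n * (n + 1) * (n + 2) := by
  rw [sum_sum_ite_le n fun i j => j + 1 - i, ← six_mul_sum_sum_range_succ]
  congr 1
  refine Finset.sum_congr rfl fun j _ => ?_
  rw [← Finset.sum_range_reflect]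
  refine Finset.sum_congr rfl fun i hi => ?_
  have := Finset.mem_range.1 hi
  omega

theorem six_mul_sum_card_initial (n : ℕ) :
    6 * ∑ i : Fin n, ∑ j : Fin n, (if i ≤ j then (i : ℕ) + 1 else 0) =
      n * (n + 1) * (n + 2) := by
  rw [sum_sum_ite_le n fun i j => i + 1, ← six_mul_sum_sum_range_succ]

theorem two_mul_sum_fin_succ (n : ℕ) : 2 * ∑ j : Fin n, ((j : ℕ) + 1) = n * (n + 1) := by
  rw [← two_mul_sum_range_succ, Finset.sum_range]

end IndexCount

/-! ### Operation counts of the individual routines and of the certificate. -/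

namespace LLLCertificate

open Counted

variable {φ : FloatFormat} {n : ℕ}

theorem add_ops (m : Rounding) (a b : Flt φ) : (add m a b).ops = 1 := rfl

theorem sub_ops (m : Rounding) (a b : Flt φ) : (sub m a b).ops = 1 := rfl

theorem mul_ops (m : Rounding) (a b : Flt φ) : (mul m a b).ops = 1 := rfl

theorem div_ops (m : Rounding) (a b : Flt φ) : (div m a b).ops = 1 := rfl

theorem sqrt_ops (m : Rounding) (a : Flt φ) : (sqrt m a).ops = 1 := rfl

theorem abs_ops (a : Flt φ) : (abs a).ops = 1 := rfl

theorem le_ops (a b : Flt φ) : (le a b).ops = 1 := rfl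

theorem lt_ops (a b : Flt φ) : (lt a b).ops = 1 := rfl

theorem conv_ops (m : Rounding) (x : ℝ) : (conv m x : Counted (Flt φ)).ops = 1 := rfl

theorem absSubBound_ops (lo hi c : Flt φ) : (absSubBound lo hi c).ops = 5 := rfl

theorem geomTail_ops (g : Flt φ) : (geomTail g).ops = 4 := rfl

theorem length_idx (P : Fin n → Prop) [DecidablePred P] :
    (idx P).length = (Finset.univ.filter P).card := by
  rw [← toFinset_idx, List.toFinset_card_of_nodup (nodup_idx P)]

theorem length_idx_le (j : Fin n) : (idx fun k => k ≤ j).length = (j : ℕ) + 1 := by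
  rw [length_idx, ← Fin.card_Iic j]
  congr 1
  ext k
  simp

theorem length_idx_Icc (i j : Fin n) :
    (idx fun k => i ≤ k ∧ k ≤ j).length = (j : ℕ) + 1 - i := by
  rw [length_idx, ← Fin.card_Icc i j]
  congr 1
  ext k
  simp

theorem length_idx_Ioc (i j : Fin n) :
    (idx fun k => i < k ∧ k ≤ j).length = (j : ℕ) - i := by
  rw [length_idx, ← Fin.card_Ioc i j]
  congr 1
  ext k
  simp

theorem dot_ops (m : Rounding) (l : List (Fin n)) (f g : Fin n → Flt φ) :
    (dot m l f g).ops = 2 * l.length := by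
  unfold dot
  rw [foldlM_ops _ (fun _ => 2) fun _ _ => rfl]
  simp [mul_comm]

theorem upperMat_ops (f : Fin n → Fin n → Counted (Flt φ)) :
    (upperMat f).ops = ∑ i, ∑ j, if i ≤ j then (f i j).ops else 0 := by
  unfold upperMat
  rw [mat_ops]
  simp only [ite_ops, pure_ops]

theorem symMat_ops (f : Fin n → Fin n → Counted (Flt φ)) :
    (symMat f).ops = ∑ i, ∑ j, if i ≤ j then (f i j).ops else 0 :=
  upperMat_ops f

theorem mat_ops_const {α : Type} {f : Fin n → Fin n → Counted α} {c : ℕ}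
    (h : ∀ i j, (f i j).ops = c) : (mat f).ops = c * n ^ 2 := by
  rw [mat_ops]
  simp only [h, Finset.sum_const, Finset.card_univ, Fintype.card_fin, smul_eq_mul]
  ring

theorem normInf_ops (M : FMat φ n) : (normInf M).ops = n ^ 2 + n := by
  have h : (normInf M).ops = (∑ i : Fin n, ((List.finRange n).foldlM
      (fun acc j => add .up acc (M i j)) Flt.zero).ops) +
      ((List.finRange n).foldlM (fun acc i => max acc (((List.finRange n).foldlM
        (fun acc j => add .up acc (M i j)) Flt.zero).val)) Flt.zero).ops := rfl
  rw [h, foldlM_ops _ (fun _ => 1) fun _ _ => rfl]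
  have h2 : ∀ i : Fin n, ((List.finRange n).foldlM
      (fun acc j => add .up acc (M i j)) Flt.zero).ops = n := by
    intro i
    rw [foldlM_ops _ (fun _ => 1) fun _ _ => rfl]
    simp
  simp [h2, sq]

/-- The 6n² come from midpoints (3), radii, absolute values and their sums. Each entry takes four
inner products, five operations for the deviation from the identity and two additions. -/
theorem gramBound_ops (K : Fin n → List (Fin n)) (Xlo Xhi : FMat φ n) :
    (gramBound K Xlo Xhi).ops = 6 * n ^ 2 +
      ∑ i : Fin n, ∑ j : Fin n, if i ≤ j then 8 * (K i).length + 7 else 0 := by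
  unfold gramBound
  simp only [bind_ops, symMat_ops, mat_ops, sub_ops, div_ops, add_ops, abs_ops, dot_ops,
    absSubBound_ops, Finset.sum_const, Finset.card_univ, Fintype.card_fin, smul_eq_mul]
  have h : ∀ i : Fin n, 2 * (K i).length + (2 * (K i).length + (5 + (2 * (K i).length +
      (2 * (K i).length + (1 + 1))))) = 8 * (K i).length + 7 := fun i => by ring
  simp only [h]
  ring

/-- An entry above the diagonal costs 2(j - i) + 2 = 2(j + 1 - i). A diagonal entry costs one
division where this formula gives 2; the added n makes up for it. -/
theorem triInv_ops (R : FMat φ n) : (triInv R).ops + n =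
    2 * ∑ i : Fin n, ∑ j : Fin n, if i ≤ j then (j : ℕ) + 1 - i else 0 := by
  unfold triInv
  rw [foldlM_ops _ (fun i : Fin n => ∑ j : Fin n, if i = j then 1 else if i < j
    then 2 * ((j : ℕ) - i) + 2 else 0)]
  · rw [List.map_reverse, List.sum_reverse, ← List.sum_toFinset _ (List.nodup_finRange n),
      List.toFinset_finRange]
    have hn : n = ∑ i : Fin n, ∑ j : Fin n, if i = j then 1 else 0 := by simp
    conv_lhs => rhs; rw [hn]
    rw [← Finset.sum_add_distrib, Finset.mul_sum]
    refine Finset.sum_congr rfl fun i _ => ?_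
    rw [← Finset.sum_add_distrib, Finset.mul_sum]
    refine Finset.sum_congr rfl fun j _ => ?_
    rcases lt_trichotomy i j with h | rfl | h
    · have : (i : ℕ) < j := h
      simp only [if_neg h.ne, if_pos h, if_pos h.le]
      omega
    · simp
    · simp [h.ne', h.not_gt, h.not_ge]
  · intro V i
    rw [bind_ops, pure_ops, add_zero, vec_ops]
    refine Finset.sum_congr rfl fun j _ => ?_
    rw [ite_ops, ite_ops]
    have h : ∀ a b : Fin n → Flt φ, (dot .nearest (idx fun k => i < k ∧ k ≤ j) a b).ops + 2 =
        2 * ((j : ℕ) - i) + 2 := by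
      intro a b
      rw [dot_ops, length_idx_Ioc]
    rw [← h (R i) fun k => V k j]
    rfl

/-- The pivot column takes an inner product, a root and n divisions. Each later column takes 2n
operations for its coefficient and 2n for its update. -/
theorem mgsStep_ops (st : FMat φ n × FMat φ n) (k : Fin n) :
    (mgsStep st k).ops = 3 * n + 1 + 4 * n * ∑ j : Fin n, if k < j then 1 else 0 := by
  unfold mgsStep
  simp only [bind_ops, pure_ops, vec_ops, mat_ops, ite_ops, dot_ops, List.length_finRange]
  have h : (∑ j : Fin n, if j = k then 0 else if k < j then 2 * n else 0) =
      2 * n * ∑ j : Fin n, if k < j then 1 else 0 := by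
    rw [Finset.mul_sum]
    refine Finset.sum_congr rfl fun j _ => ?_
    rcases lt_trichotomy j k with h | rfl | h
    · simp [h.ne, h.not_gt]
    · simp
    · simp [h.ne', h]
  have h2 : (∑ j : Fin n, if k < j then 2 else 0) = 2 * ∑ j : Fin n, if k < j then 1 else 0 := by
    simp only [Finset.mul_sum, mul_ite, mul_one, mul_zero]
  simp only [sqrt_ops, div_ops, mul_ops, sub_ops, Nat.reduceAdd, h, h2, Finset.sum_const,
    Finset.card_univ, Fintype.card_fin, smul_eq_mul]
  ring

theorem mgs_ops (A : FMat φ n) : (mgs A).ops = 3 * n ^ 2 + n +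
    4 * n * ∑ i : Fin n, ∑ j : Fin n, if i < j then 1 else 0 := by
  unfold mgs
  rw [bind_ops, pure_ops, add_zero, foldlM_ops _ _ mgsStep_ops,
    ← List.sum_toFinset _ (List.nodup_finRange n), List.toFinset_finRange]
  rw [Finset.sum_add_distrib, ← Finset.mul_sum]
  simp only [Finset.sum_const, Finset.card_univ, Fintype.card_fin, smul_eq_mul]
  ring

/-- The number of pairs and triples of indices entering the operation counts. -/
theorem index_counts (n : ℕ) :
    ((∑ i : Fin n, ∑ j : Fin n, (if i ≤ j then 1 else 0) : ℕ) : ℝ) = n * (n + 1) / 2 ∧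
    ((∑ i : Fin n, ∑ j : Fin n, (if i < j then 1 else 0) : ℕ) : ℝ) = n * (n + 1) / 2 - n ∧
    ((∑ i : Fin n, ∑ j : Fin n, (if i ≤ j then (j : ℕ) + 1 - i else 0) : ℕ) : ℝ) =
      n * (n + 1) * (n + 2) / 6 ∧
    ((∑ i : Fin n, ∑ j : Fin n, (if i ≤ j then (i : ℕ) + 1 else 0) : ℕ) : ℝ) =
      n * (n + 1) * (n + 2) / 6 ∧
    ((∑ j : Fin n, ((j : ℕ) + 1) : ℕ) : ℝ) = n * (n + 1) / 2 := by
  have h1 := congrArg (Nat.cast : ℕ → ℝ) (two_mul_card_le n)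
  have h2 := congrArg (Nat.cast : ℕ → ℝ) (card_lt_add n)
  have h3 := congrArg (Nat.cast : ℕ → ℝ) (six_mul_sum_card_interval n)
  have h4 := congrArg (Nat.cast : ℕ → ℝ) (six_mul_sum_card_initial n)
  have h5 := congrArg (Nat.cast : ℕ → ℝ) (two_mul_sum_fin_succ n)
  rw [Nat.cast_add] at h2
  rw [Nat.cast_mul, Nat.cast_mul] at h1 h5
  rw [Nat.cast_mul, Nat.cast_mul, Nat.cast_mul] at h3 h4
  generalize ((∑ i : Fin n, ∑ j : Fin n, (if i ≤ j then 1 else 0) : ℕ) : ℝ) = a1 at *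
  generalize ((∑ i : Fin n, ∑ j : Fin n, (if i < j then 1 else 0) : ℕ) : ℝ) = a2 at *
  generalize ((∑ i : Fin n, ∑ j : Fin n, (if i ≤ j then (j : ℕ) + 1 - i else 0) : ℕ) : ℝ) = a3 at *
  generalize ((∑ i : Fin n, ∑ j : Fin n, (if i ≤ j then (i : ℕ) + 1 else 0) : ℕ) : ℝ) = a4 at *
  generalize ((∑ j : Fin n, ((j : ℕ) + 1) : ℕ) : ℝ) = a5 at *
  push_cast at *
  refine ⟨?_, ?_, ?_, ?_, ?_⟩ <;> linarith

/-- The leading terms, in units of n³: 1/3 for V, 2/3 for W, 4/3 for its Gram bound, 2 for the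
enclosure of AV, 4 for its Gram bound, 1 + 1/3 for the two products with B, and 1/3 for F. -/
theorem errorBound_ops (Alo Ahi R' : FMat φ n) :
    ((errorBound Alo Ahi R').ops : ℝ) = 10 * n ^ 3 + 46 * n ^ 2 + 20 * n + 10 := by
  have hT := triInv_ops R'
  obtain ⟨h1, -, h3, h4, h5⟩ := index_counts n
  have hsplit : ∀ f : Fin n → ℕ, ∑ i : Fin n, ∑ j : Fin n, (if i ≤ j then 8 * f i + 7 else 0) =
      8 * (∑ i : Fin n, ∑ j : Fin n, if i ≤ j then f i else 0) +
        7 * ∑ i : Fin n, ∑ j : Fin n, if i ≤ j then 1 else 0 := by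
    intro f
    simp only [Finset.mul_sum, ← Finset.sum_add_distrib]
    refine Finset.sum_congr rfl fun i _ => Finset.sum_congr rfl fun j _ => ?_
    split_ifs <;> rfl
  have hc : ∀ (c : ℕ) (f : Fin n → Fin n → ℕ),
      ∑ i : Fin n, ∑ j : Fin n, (if i ≤ j then c * f i j else 0) =
        c * ∑ i : Fin n, ∑ j : Fin n, if i ≤ j then f i j else 0 := by
    intro c f
    simp only [Finset.mul_sum, mul_ite, mul_zero]
  have hn : ∑ i : Fin n, ∑ j : Fin n, (if i ≤ j then n else 0) =
      n * ∑ i : Fin n, ∑ j : Fin n, if i ≤ j then 1 else 0 := by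
    simp only [Finset.mul_sum, mul_ite, mul_zero, mul_one]
  have h : (errorBound Alo Ahi R').ops = (triInv R').ops +
      6 * (∑ i : Fin n, ∑ j : Fin n, if i ≤ j then (j : ℕ) + 1 - i else 0) +
      10 * (∑ i : Fin n, ∑ j : Fin n, if i ≤ j then (i : ℕ) + 1 else 0) +
      (26 + 8 * n) * (∑ i : Fin n, ∑ j : Fin n, if i ≤ j then 1 else 0) +
      6 * n * (∑ j : Fin n, ((j : ℕ) + 1)) + 17 * n ^ 2 + 2 * n + 10 := by
    unfold errorBound
    simp only [bind_ops, pure_ops, normInf_ops, lt_ops, geomTail_ops, gramBound_ops]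
    simp only [upperMat_ops, symMat_ops, mat_ops, dot_ops, length_idx_le, length_idx_Icc,
      absSubBound_ops, add_ops, abs_ops, le_ops, List.length_finRange, hsplit]
    simp only [hc 2, hc 5 fun _ _ => 1, hn, Finset.sum_const, Finset.card_univ, Fintype.card_fin,
      smul_eq_mul, ← Finset.mul_sum]
    ring
  have hT' : ((triInv R').ops : ℝ) + n = 2 * (n * (n + 1) * (n + 2) / 6) := by
    rw [← h3]
    exact_mod_cast hT
  rw [h]
  rw [Nat.cast_add, Nat.cast_add, Nat.cast_add, Nat.cast_add, Nat.cast_add, Nat.cast_add,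
    Nat.cast_add, Nat.cast_mul 6, h3, Nat.cast_mul 10, h4, Nat.cast_mul (26 + 8 * n), h1,
    Nat.cast_mul (6 * n), h5]
  push_cast
  linarith

theorem finiteTest_ops (F : FMat φ n) : (finiteTest F).ops = 2 * n ^ 2 := by
  unfold finiteTest
  rw [bind_ops, pure_ops, add_zero]
  exact mat_ops_const fun _ _ => rfl

theorem properTest_ops (R' F : FMat φ n) (η : ℝ) : (properTest R' F η).ops =
    1 + 5 * ∑ i : Fin n, ∑ j : Fin n, if i < j then 1 else 0 := by
  unfold properTest
  simp only [bind_ops, pure_ops, mat_ops, ite_ops, sub_ops, mul_ops, add_ops, abs_ops, le_ops,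
    conv_ops, Finset.mul_sum, mul_ite, mul_one, mul_zero, add_zero]

theorem lovaszTest_ops_le (R' F : FMat φ n) (δ : ℝ) : (lovaszTest R' F δ).ops ≤ 1 + 12 * n := by
  unfold lovaszTest
  rw [bind_ops, bind_ops, pure_ops, add_zero, vec_ops]
  have h : 12 * n = ∑ _i : Fin n, 12 := by simp [mul_comm]
  rw [h]
  refine add_le_add le_rfl (Finset.sum_le_sum fun i _ => ?_)
  split_ifs
  · exact le_rfl
  · exact Nat.zero_le _

theorem certificate_ops_bound (A : Matrix (Fin n) (Fin n) ℤ) (δ η : ℝ) (hn : 1 ≤ n) :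
    |((certificate φ A δ η).ops : ℝ) - 12 * (n : ℝ) ^ 3| ≤ 200 * (n : ℝ) ^ 2 := by
  have h7 : (1 : ℝ) ≤ n := by exact_mod_cast hn
  -- For n ≥ 1 linear and constant terms are absorbed into n²; the constant 200 leaves ample room.
  have h8 : (n : ℝ) ≤ n ^ 2 := by nlinarith
  obtain ⟨-, h2, -⟩ := index_counts n
  obtain ⟨A0, R', F, h⟩ : ∃ A0 R' F : FMat φ n, (certificate φ A δ η).ops =
      n ^ 2 + ((mgs A0).ops + (n ^ 2 + (n ^ 2 +
        ((errorBound (fun i j => Flt.ofReal .down (A i j : ℝ))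
        (fun i j => Flt.ofReal .up (A i j : ℝ)) R').ops + ((finiteTest F).ops +
          ((properTest R' F η).ops + (lovaszTest R' F δ).ops)))))) := by
    refine ⟨fun i j => Flt.ofReal .nearest (A i j : ℝ),
      (mgs fun i j => (Flt.ofReal .nearest (A i j : ℝ) : Flt φ)).val,
      (errorBound (fun i j => Flt.ofReal .down (A i j : ℝ)) (fun i j => Flt.ofReal .up (A i j : ℝ))
        (mgs fun i j => (Flt.ofReal .nearest (A i j : ℝ) : Flt φ)).val).val, ?_⟩
    unfold certificate
    simp only [bind_ops, pure_ops, add_zero]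
    rw [mat_ops_const (c := 1) fun _ _ => rfl, mat_ops_const (c := 1) fun _ _ => rfl,
      mat_ops_const (c := 1) fun _ _ => rfl, one_mul]
    rfl
  have h3 : ((mgs A0).ops : ℝ) = 2 * n ^ 3 + n ^ 2 + n := by
    rw [mgs_ops, Nat.cast_add, Nat.cast_mul (4 * n), h2]
    push_cast
    ring
  have h4 : ((properTest R' F η).ops : ℝ) = 1 + 5 * (n * (n + 1) / 2 - n) := by
    rw [properTest_ops, Nat.cast_add, Nat.cast_mul, h2]
    push_cast
    ring
  have h5 : ((lovaszTest R' F δ).ops : ℝ) ≤ 1 + 12 * n := by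
    exact_mod_cast lovaszTest_ops_le R' F δ
  have h6 : (0 : ℝ) ≤ ((lovaszTest R' F δ).ops : ℝ) := Nat.cast_nonneg _
  have h9 := errorBound_ops (fun i j => Flt.ofReal .down (A i j : ℝ))
    (fun i j => Flt.ofReal .up (A i j : ℝ)) R'
  rw [h, finiteTest_ops]
  generalize (mgs A0).ops = x1 at h3 ⊢
  generalize (properTest R' F η).ops = x2 at h4 ⊢
  generalize (lovaszTest R' F δ).ops = x3 at h5 h6 ⊢
  generalize (errorBound _ _ R').ops = x4 at h9 ⊢
  push_cast
  rw [abs_le]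
  constructor <;> linarith

end LLLCertificate

theorem theorem4 :
    ∃ C : ℝ, ∀ (φ : FloatFormat) (n : ℕ) (A : Matrix (Fin n) (Fin n) ℤ) (δ η : ℝ),
      A.det ≠ 0 → 1 / 4 < δ → δ ≤ 1 → 1 / 2 ≤ η → η < Real.sqrt δ →
        -- the number of operations is `12 n ^ 3 + O(n ^ 2)`
        (1 ≤ n →
          |((LLLCertificate.certificate φ A δ η).ops : ℝ) - 12 * (n : ℝ) ^ 3| ≤
            C * (n : ℝ) ^ 2) ∧
        -- the `QR` factor exists, is unique, and carries the Gram-Schmidt data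
        (∃! R : Matrix (Fin n) (Fin n) ℝ, IsQRFactor (A.map (Int.cast : ℤ → ℝ)) R) ∧
        (∀ R : Matrix (Fin n) (Fin n) ℝ, IsQRFactor (A.map (Int.cast : ℤ → ℝ)) R →
          (∀ i, ‖gsVec A i‖ = R i i) ∧ (∀ i j, j < i → gsCoeff A i j = R j i / R j j) ∧
          -- the computed bound, when finite, is an error bound
          ((∀ i j, ((LLLCertificate.certificate φ A δ η).val.F i j).IsFinite) →
            ∀ i j, ((LLLCertificate.certificate φ A δ η).val.Rapprox i j).IsFinite ∧
              |((LLLCertificate.certificate φ A δ η).val.Rapprox i j).toReal - R i j| ≤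
                ((LLLCertificate.certificate φ A δ η).val.F i j).toReal)) ∧
        -- the answer is `failed`, or the basis is LLL-reduced
        ((LLLCertificate.certificate φ A δ η).val.answer = LLLCertificate.Answer.failed ∨
          ((LLLCertificate.certificate φ A δ η).val.answer = LLLCertificate.Answer.reduced ∧
            IsLLLReduced A δ η)) := by
  refine ⟨200, fun φ n A δ η hA hδ _ hη _ => ⟨LLLCertificate.certificate_ops_bound A δ η,
    existsUnique_isQRFactor hA, fun R hR => ⟨hR.norm_gsVec, fun i j _ => hR.gsCoeff i j,
      fun hF => LLLCertificate.certificate_error_bound hR hF⟩,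
    LLLCertificate.certificate_sound hA (by linarith) (by linarith)⟩⟩
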